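/- **Conventions.** A Petri net $N$ consists of sets of places and of transitions, every transition having a finite word of input places and a finite word of output places (a multiset with a chosen ordering). $\mathfrak F(N)$ denotes the free symmetric strict monoidal category on $N$, with the words of places as objects and one generating morphism per transition. Let $\mathcal S$ be one of the following two symmetric strict monoidal categories: the strictification $\mathbf{Set}_*$ of the category of sets and partial functions, or the strictification $\mathbf{Span}$ of the category of sets and isomorphism classes of spans (both with the cartesian product of sets as tensor product). A *net with $\mathcal S$-semantics* $(N,N^\sharp)$ is a net $N$ with a strict symmetric monoidal functor $N^\sharp:\mathfrak F(N)\to\mathcal S$. A *subnet* $(M,M^\sharp)$ of $(N,N^\sharp)$ is given by some of the places and some of the transitions of $N$ (up to renaming, with the same inputs and outputs), with $M^\sharp=\mathrm{sub}_M;N^\sharp$, where $\mathrm{sub}_M:\mathfrak F(M)\to\mathfrak F(N)$ is the induced strict symmetric monoidal functor and $;$ is composition in diagrammatic order. $\overline M$ is the net with the places of $M$ and no transitions, with the restricted semantics. These notions make sense for every symmetric strict monoidal category $\mathcal S$; for the terminal one they are the notions for plain nets. Let $(N_w,N_w^\sharp)$ be a subnet of $(N,N^\sharp)$. An *erasing of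 generators of $(N,N^\sharp)$ via $N_w$* is a subnet $(K,K^\sharp)$ of $(N,N^\sharp)$ such that $\overline{N_w}$ is a subnet of $K$ and $$\begin{array}{ccc}\mathfrak F(\overline{N_w})&\to&\mathfrak F(K)\\ \downarrow&&\downarrow\\ \mathfrak F(N_w)&\to&\mathfrak F(N)\end{array}$$ (with the functors induced by the subnets) is a pushout of symmetric strict monoidal categories and strict symmetric monoidal functors. The *internalization* $\int N^\sharp$ is the symmetric strict monoidal category whose objects are the pairs $(X,x)$ with $X$ an object of $\mathfrak F(N)$ and $x\in N^\sharp X$. For $\mathcal S=\mathbf{Set}_*$ a morphism $(X,x)\to(Y,y)$ is a morphism $f:X\to Y$ with $N^\sharp f$ defined at $x$ and $N^\sharp f(x)=y$. For $\mathcal S=\mathbf{Span}$ a morphism $(X,x)\to(Y,y)$ is a pair $(f,s)$ with $f:X\to Y$ and $s$ an element over $(x,y)$ of the apex of the span $N^\sharp f$. Since $N^\sharp f$ is only an isomorphism class, this refers, in the span case, to a *realization* of $N^\sharp$: a choice of a representing span for every $f$, together with identifications of the span of $f;g$ with the pullback, and of the span of $f\otimes g$ with the product, of the spans of $f$ and $g$,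 so coherent that the pairs $(f,s)$ form a symmetric strict monoidal category. A subnet inclusion $\mathrm{sub}_M$ lifts to a strict symmetric monoidal functor $\widehat{\mathrm{sub}_M}:\int M^\sharp=\int(\mathrm{sub}_M;N^\sharp)\to\int N^\sharp$, given by $(X,x)\mapsto(\mathrm{sub}_MX,x)$ and $f\mapsto\mathrm{sub}_Mf$ (resp. $(f,s)\mapsto(\mathrm{sub}_Mf,s)$); in the span case $M^\sharp$ has the restricted realization. **Lemma.** Let $(K,K^\sharp)$ be an erasing of generators of $(N,N^\sharp)$ via a subnet $(N_w,N_w^\sharp)$, and in the span case let a realization of $N^\sharp$ be given. Then $\int K^\sharp$ is an erasing of generators of $\int N^\sharp$ via $\int(\mathrm{sub}_{N_w};N^\sharp)$. That is: there are Petri nets $\tilde N$, $\tilde N_w$, $\tilde K$ with isomorphisms of symmetric strict monoidal categories $\mathfrak F(\tilde N)\cong\int N^\sharp$, $\mathfrak F(\tilde N_w)\cong\int(\mathrm{sub}_{N_w};N^\sharp)$, $\mathfrak F(\tilde K)\cong\int K^\sharp$, such that $\tilde N_w$ and $\tilde K$ are subnets of $\tilde N$ whose inclusions correspond under these isomorphisms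 to $\widehat{\mathrm{sub}_{N_w}}$ and $\widehat{\mathrm{sub}_K}$, and $\tilde K$ is an erasing of generators of $\tilde N$ via $\tilde N_w$. -/

import Mathlib

open CategoryTheory

set_option linter.unusedSectionVars false
set_option linter.unusedVariables false

universe u v w v₁ v₂ v₃ u₁ u₂ u₃

namespace GuardedNets

/-! ### Symmetric strict monoidal categories -/

/-- A symmetric strict monoidal category: the objects form a monoid, the morphisms carry a
functorial tensor product that is strictly associative and unital, and there is a natural,
involutive braiding satisfying the hexagon identity. Equations between morphisms whose (equal)
endpoints are syntactically different are heterogeneous equalities. -/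
class StrictSymmMon (C : Type u) [Category.{v} C] extends Monoid C where
  tensor : ∀ {a b c d : C}, (a ⟶ b) → (c ⟶ d) → (a * c ⟶ b * d)
  tensor_id : ∀ a b : C, tensor (𝟙 a) (𝟙 b) = 𝟙 (a * b)
  tensor_comp : ∀ {a b c a' b' c' : C} (f : a ⟶ b) (g : b ⟶ c) (f' : a' ⟶ b') (g' : b' ⟶ c'),
    tensor (f ≫ g) (f' ≫ g') = tensor f f' ≫ tensor g g'
  tensor_assoc : ∀ {a b c a' b' c' : C} (f : a ⟶ a') (g : b ⟶ b') (h : c ⟶ c'),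
    HEq (tensor (tensor f g) h) (tensor f (tensor g h))
  unit_tensor : ∀ {a b : C} (f : a ⟶ b), HEq (tensor (𝟙 (1 : C)) f) f
  tensor_unit : ∀ {a b : C} (f : a ⟶ b), HEq (tensor f (𝟙 (1 : C))) f
  braid : ∀ a b : C, a * b ⟶ b * a
  braid_natural : ∀ {a b c d : C} (f : a ⟶ b) (g : c ⟶ d),
    tensor f g ≫ braid b d = braid a c ≫ tensor g f
  braid_braid : ∀ a b : C, braid a b ≫ braid b a = 𝟙 (a * b)
  hexagon : ∀ a b c : C, HEq (braid a (b * c))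
    (tensor (braid a b) (𝟙 c) ≫ eqToHom (mul_assoc b a c) ≫ tensor (𝟙 b) (braid a c))

open StrictSymmMon

/-- A strict symmetric monoidal functor between symmetric strict monoidal categories. -/
structure StrictFunctor (C : Type u₁) [Category.{v₁} C] [StrictSymmMon C]
    (D : Type u₂) [Category.{v₂} D] [StrictSymmMon D] extends C ⥤ D where
  obj_one : obj 1 = 1
  obj_mul : ∀ X Y, obj (X * Y) = obj X * obj Y
  map_tensor : ∀ {X Y X' Y' : C} (f : X ⟶ Y) (g : X' ⟶ Y'),
    HEq (map (tensor f g)) (tensor (map f) (map g))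
  map_braid : ∀ X Y : C, HEq (map (braid X Y)) (braid (obj X) (obj Y))

section

variable {C : Type u₁} [Category.{v₁} C] [StrictSymmMon C]
  {D : Type u₂} [Category.{v₂} D] [StrictSymmMon D]
  {E : Type u₃} [Category.{v₃} E] [StrictSymmMon E]

theorem tensor_heq {a b c d a' b' c' d' : C} (ha : a = a') (hb : b = b') (hc : c = c')
    (hd : d = d') {f : a ⟶ b} {f' : a' ⟶ b'} {g : c ⟶ d} {g' : c' ⟶ d'}
    (hf : HEq f f') (hg : HEq g g') : HEq (tensor f g) (tensor f' g') := by
  subst ha hb hc hd; cases hf; cases hg; rfl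

theorem comp_heq' {a b c a' b' c' : C} (ha : a = a') (hb : b = b') (hc : c = c')
    {f : a ⟶ b} {f' : a' ⟶ b'} {g : b ⟶ c} {g' : b' ⟶ c'}
    (hf : HEq f f') (hg : HEq g g') : HEq (f ≫ g) (f' ≫ g') := by
  subst ha hb hc; cases hf; cases hg; rfl

theorem map_heq (F : C ⥤ D) {a b a' b' : C} (ha : a = a') (hb : b = b')
    {f : a ⟶ b} {f' : a' ⟶ b'} (hf : HEq f f') : HEq (F.map f) (F.map f') := by
  subst ha hb; cases hf; rfl

theorem id_heq {a a' : C} (ha : a = a') : HEq (𝟙 a) (𝟙 a') := by subst ha; rfl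

theorem eqToHom_heq_id {a b : C} (h : a = b) : HEq (eqToHom h) (𝟙 a) := by subst h; rfl

namespace StrictFunctor

theorem ext' {F G : StrictFunctor C D} (h : F.toFunctor = G.toFunctor) : F = G := by
  cases F; cases G; cases h; rfl

/-- The identity functor. -/
def id (C : Type u₁) [Category.{v₁} C] [StrictSymmMon C] : StrictFunctor C C where
  toFunctor := 𝟭 C
  obj_one := rfl
  obj_mul _ _ := rfl
  map_tensor _ _ := HEq.rfl
  map_braid _ _ := HEq.rfl

/-- Composition in diagrammatic order. -/
def comp (F : StrictFunctor C D) (G : StrictFunctor D E) : StrictFunctor C E where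
  toFunctor := F.toFunctor ⋙ G.toFunctor
  obj_one := (congrArg G.obj F.obj_one).trans G.obj_one
  obj_mul X Y := (congrArg G.obj (F.obj_mul X Y)).trans (G.obj_mul _ _)
  map_tensor f g := (map_heq G.toFunctor (F.obj_mul _ _) (F.obj_mul _ _) (F.map_tensor f g)).trans
    (G.map_tensor _ _)
  map_braid X Y := (map_heq G.toFunctor (F.obj_mul _ _) (F.obj_mul _ _) (F.map_braid X Y)).trans
    (G.map_braid _ _)

end StrictFunctor

end

/-- Small symmetric strict monoidal categories, as the objects of a category. -/
structure SSMCat : Type (u + 1) where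
  carrier : Type u
  [cat : Category.{u} carrier]
  [str : StrictSymmMon carrier]

attribute [instance] SSMCat.cat SSMCat.str

/-- The category of small symmetric strict monoidal categories and strict symmetric monoidal
functors. -/
instance : Category SSMCat.{u} where
  Hom A B := StrictFunctor A.carrier B.carrier
  id A := StrictFunctor.id A.carrier
  comp F G := F.comp G
  id_comp _ := StrictFunctor.ext' rfl
  comp_id _ := StrictFunctor.ext' rfl
  assoc _ _ _ := StrictFunctor.ext' rfl

/-- A strict symmetric monoidal functor, seen as a morphism of `SSMCat`. -/
def StrictFunctor.toHom {A B : Type u} [Category.{u} A] [StrictSymmMon A] [Category.{u} B]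
    [StrictSymmMon B] (F : StrictFunctor A B) : SSMCat.mk A ⟶ SSMCat.mk B := F

/-! ### Petri nets and the free symmetric strict monoidal categories on them -/

/-- A Petri net. The input and output multisets of every transition come with a chosen ordering,
as is needed to form the free symmetric strict monoidal category on the net. -/
structure PetriNet : Type (u + 1) where
  Place : Type u
  Trans : Type u
  src : Trans → FreeMonoid Place
  tgt : Trans → FreeMonoid Place

namespace PetriNet

/-- The objects of the free symmetric strict monoidal category on `N`: words of places. -/
def Free (N : PetriNet.{u}) : Type u := FreeMonoid N.Place

instance (N : PetriNet.{u}) : Monoid N.Free := inferInstanceAs (Monoid (FreeMonoid N.Place))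

/-- Formal expressions for the morphisms of the free symmetric strict monoidal category. -/
inductive Term (N : PetriNet.{u}) : N.Free → N.Free → Type u
  | id (a : N.Free) : Term N a a
  | comp {a b c : N.Free} (f : Term N a b) (g : Term N b c) : Term N a c
  | tensor {a b c d : N.Free} (f : Term N a b) (g : Term N c d) : Term N (a * c) (b * d)
  | braid (a b : N.Free) : Term N (a * b) (b * a)
  | gen (t : N.Trans) : Term N (N.src t) (N.tgt t)

/-- The formal identity along an equality of objects. -/
def Term.ofEq {N : PetriNet.{u}} {a b : N.Free} (h : a = b) : Term N a b := h ▸ Term.id a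

/-- The congruence generated by the axioms of a symmetric strict monoidal category. Related
expressions have equal endpoints (`Rel.endpoints`). -/
inductive Rel (N : PetriNet.{u}) : ∀ {a b a' b' : N.Free}, Term N a b → Term N a' b' → Prop
  | refl {a b : N.Free} (f : Term N a b) : Rel N f f
  | symm {a b a' b' : N.Free} {f : Term N a b} {g : Term N a' b'} : Rel N f g → Rel N g f
  | trans {a b a' b' a'' b'' : N.Free} {f : Term N a b} {g : Term N a' b'}
      {h : Term N a'' b''} : Rel N f g → Rel N g h → Rel N f h
  | comp_congr {a b c a' b' c' : N.Free} {f : Term N a b} {g : Term N b c}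
      {f' : Term N a' b'} {g' : Term N b' c'} :
      Rel N f f' → Rel N g g' → Rel N (f.comp g) (f'.comp g')
  | tensor_congr {a b c d a' b' c' d' : N.Free} {f : Term N a b} {g : Term N c d}
      {f' : Term N a' b'} {g' : Term N c' d'} :
      Rel N f f' → Rel N g g' → Rel N (f.tensor g) (f'.tensor g')
  | id_comp {a b : N.Free} (f : Term N a b) : Rel N ((Term.id a).comp f) f
  | comp_id {a b : N.Free} (f : Term N a b) : Rel N (f.comp (Term.id b)) f
  | assoc {a b c d : N.Free} (f : Term N a b) (g : Term N b c) (h : Term N c d) :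
      Rel N ((f.comp g).comp h) (f.comp (g.comp h))
  | tensor_id (a b : N.Free) : Rel N ((Term.id a).tensor (Term.id b)) (Term.id (a * b))
  | tensor_comp {a b c a' b' c' : N.Free} (f : Term N a b) (g : Term N b c)
      (f' : Term N a' b') (g' : Term N b' c') :
      Rel N ((f.comp g).tensor (f'.comp g')) ((f.tensor f').comp (g.tensor g'))
  | tensor_assoc {a b c a' b' c' : N.Free} (f : Term N a a') (g : Term N b b')
      (h : Term N c c') : Rel N ((f.tensor g).tensor h) (f.tensor (g.tensor h))
  | unit_tensor {a b : N.Free} (f : Term N a b) : Rel N ((Term.id 1).tensor f) f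
  | tensor_unit {a b : N.Free} (f : Term N a b) : Rel N (f.tensor (Term.id 1)) f
  | braid_natural {a b c d : N.Free} (f : Term N a b) (g : Term N c d) :
      Rel N ((f.tensor g).comp (Term.braid b d)) ((Term.braid a c).comp (g.tensor f))
  | braid_braid (a b : N.Free) : Rel N ((Term.braid a b).comp (Term.braid b a)) (Term.id (a * b))
  | hexagon (a b c : N.Free) : Rel N (Term.braid a (b * c))
      (((Term.braid a b).tensor (Term.id c)).comp
        ((Term.ofEq (mul_assoc b a c)).comp ((Term.id b).tensor (Term.braid a c))))

theorem Rel.endpoints {N : PetriNet.{u}} {a b a' b' : N.Free} {f : Term N a b}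
    {g : Term N a' b'} (h : Rel N f g) : a = a' ∧ b = b' := by
  induction h with
  | refl => exact ⟨rfl, rfl⟩
  | symm _ ih => exact ⟨ih.1.symm, ih.2.symm⟩
  | trans _ _ ih ih' => exact ⟨ih.1.trans ih'.1, ih.2.trans ih'.2⟩
  | comp_congr _ _ ih ih' => exact ⟨ih.1, ih'.2⟩
  | tensor_congr _ _ ih ih' =>
    exact ⟨congrArg₂ (· * ·) ih.1 ih'.1, congrArg₂ (· * ·) ih.2 ih'.2⟩
  | tensor_assoc => exact ⟨mul_assoc _ _ _, mul_assoc _ _ _⟩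
  | unit_tensor => exact ⟨one_mul _, one_mul _⟩
  | tensor_unit => exact ⟨mul_one _, mul_one _⟩
  | hexagon => exact ⟨(mul_assoc _ _ _).symm, mul_assoc _ _ _⟩
  | _ => exact ⟨rfl, rfl⟩

/-- Expressions between fixed objects up to the congruence. -/
instance termSetoid (N : PetriNet.{u}) (a b : N.Free) : Setoid (Term N a b) where
  r f g := Rel N f g
  iseqv := ⟨Rel.refl, Rel.symm, Rel.trans⟩

theorem mk_heq {N : PetriNet.{u}} {a b a' b' : N.Free} {f : Term N a b} {g : Term N a' b'}
    (h : Rel N f g) :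
    HEq (Quotient.mk (termSetoid N a b) f) (Quotient.mk (termSetoid N a' b') g) := by
  obtain ⟨ha, hb⟩ := h.endpoints
  subst ha hb
  exact heq_of_eq (Quotient.sound h)

instance (N : PetriNet.{u}) : Category.{u} N.Free where
  Hom a b := Quotient (termSetoid N a b)
  id a := Quotient.mk _ (Term.id a)
  comp f g := Quotient.map₂ Term.comp (fun _ _ h _ _ h' => Rel.comp_congr h h') f g
  id_comp := by rintro _ _ ⟨f⟩; exact Quotient.sound (Rel.id_comp f)
  comp_id := by rintro _ _ ⟨f⟩; exact Quotient.sound (Rel.comp_id f)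
  assoc := by rintro _ _ _ _ ⟨f⟩ ⟨g⟩ ⟨h⟩; exact Quotient.sound (Rel.assoc f g h)

/-- The morphism of the free symmetric strict monoidal category given by an expression. -/
def Term.hom {N : PetriNet.{u}} {a b : N.Free} (f : Term N a b) : a ⟶ b := Quotient.mk _ f

theorem Term.hom_ofEq {N : PetriNet.{u}} {a b : N.Free} (h : a = b) :
    eqToHom h = (Term.ofEq h).hom := by
  subst h; rfl

/-- The free symmetric strict monoidal category on a Petri net. -/
instance (N : PetriNet.{u}) : StrictSymmMon N.Free where
  tensor f g := Quotient.map₂ Term.tensor (fun _ _ h _ _ h' => Rel.tensor_congr h h') f g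
  tensor_id a b := Quotient.sound (Rel.tensor_id a b)
  tensor_comp := by
    rintro _ _ _ _ _ _ ⟨f⟩ ⟨g⟩ ⟨f'⟩ ⟨g'⟩; exact Quotient.sound (Rel.tensor_comp f g f' g')
  tensor_assoc := by rintro _ _ _ _ _ _ ⟨f⟩ ⟨g⟩ ⟨h⟩; exact mk_heq (Rel.tensor_assoc f g h)
  unit_tensor := by rintro _ _ ⟨f⟩; exact mk_heq (Rel.unit_tensor f)
  tensor_unit := by rintro _ _ ⟨f⟩; exact mk_heq (Rel.tensor_unit f)
  braid a b := (Term.braid a b).hom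
  braid_natural := by rintro _ _ _ _ ⟨f⟩ ⟨g⟩; exact Quotient.sound (Rel.braid_natural f g)
  braid_braid a b := Quotient.sound (Rel.braid_braid a b)
  hexagon a b c := by rw [Term.hom_ofEq]; exact mk_heq (Rel.hexagon a b c)

/-- The word consisting of one place, a generating object. -/
def ofPlace {N : PetriNet.{u}} (p : N.Place) : N.Free := FreeMonoid.of p

/-- The generating morphism given by a transition. -/
def ofTrans {N : PetriNet.{u}} (t : N.Trans) :
    (show N.Free from N.src t) ⟶ (show N.Free from N.tgt t) := (Term.gen t).hom

/-! #### The universal property: extending an assignment on generators to a functor -/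

section lift

variable {N : PetriNet.{u}} {D : Type u₂} [Category.{v₂} D] [StrictSymmMon D]

/-- The extension of an assignment on places to all objects. -/
def liftObj (o : N.Place → D) (a : N.Free) : D := FreeMonoid.lift o a

theorem liftObj_mul (o : N.Place → D) (a b : N.Free) :
    liftObj o (a * b) = liftObj o a * liftObj o b := map_mul (FreeMonoid.lift o) a b

theorem liftObj_one (o : N.Place → D) : liftObj o (1 : N.Free) = 1 := map_one (FreeMonoid.lift o)

/-- The value of an expression in a symmetric strict monoidal category. -/
def Term.eval (o : N.Place → D)
    (m : ∀ t : N.Trans, liftObj o (N.src t) ⟶ liftObj o (N.tgt t)) :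
    ∀ {a b : N.Free}, Term N a b → (liftObj o a ⟶ liftObj o b)
  | _, _, .id a => 𝟙 _
  | _, _, .comp f g => Term.eval o m f ≫ Term.eval o m g
  | _, _, .tensor f g => eqToHom (liftObj_mul o _ _) ≫
      StrictSymmMon.tensor (Term.eval o m f) (Term.eval o m g) ≫
        eqToHom (liftObj_mul o _ _).symm
  | _, _, .braid a b => eqToHom (liftObj_mul o _ _) ≫
      StrictSymmMon.braid (liftObj o a) (liftObj o b) ≫ eqToHom (liftObj_mul o _ _).symm
  | _, _, .gen t => m t

theorem conj_heq {a b a' b' : D} (h : a = a') (f : a' ⟶ b') (h' : b' = b) :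
    HEq (eqToHom h ≫ f ≫ eqToHom h') f := by
  subst h h'; simp

variable (o : N.Place → D) (m : ∀ t : N.Trans, liftObj o (N.src t) ⟶ liftObj o (N.tgt t))

theorem Term.eval_tensor {a b c d : N.Free} (f : Term N a b) (g : Term N c d) :
    HEq ((f.tensor g).eval o m) (StrictSymmMon.tensor (f.eval o m) (g.eval o m)) :=
  conj_heq _ _ _

theorem Term.eval_braid (a b : N.Free) :
    HEq ((Term.braid a b).eval o m) (StrictSymmMon.braid (liftObj o a) (liftObj o b)) :=
  conj_heq _ _ _

theorem Term.eval_ofEq {a b : N.Free} (h : a = b) :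
    (Term.ofEq h).eval o m = eqToHom (congrArg (liftObj o) h) := by
  subst h; rfl

theorem Term.eval_rel {a b a' b' : N.Free} {f : Term N a b} {g : Term N a' b'} (h : Rel N f g) :
    HEq (f.eval o m) (g.eval o m) := by
  have M := liftObj_mul o
  have U := liftObj_one o
  induction h with
  | refl => rfl
  | symm _ ih => exact ih.symm
  | trans _ _ ih ih' => exact ih.trans ih'
  | comp_congr h h' ih ih' =>
    exact comp_heq' (congrArg _ h.endpoints.1) (congrArg _ h.endpoints.2)
      (congrArg _ h'.endpoints.2) ih ih'
  | tensor_congr h h' ih ih' =>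
    exact (eval_tensor o m _ _).trans ((tensor_heq (congrArg _ h.endpoints.1)
      (congrArg _ h.endpoints.2) (congrArg _ h'.endpoints.1)
      (congrArg _ h'.endpoints.2) ih ih').trans (eval_tensor o m _ _).symm)
  | id_comp f => exact heq_of_eq (Category.id_comp _)
  | comp_id f => exact heq_of_eq (Category.comp_id _)
  | assoc f g h => exact heq_of_eq (Category.assoc _ _ _)
  | tensor_id a b =>
    refine (eval_tensor o m _ _).trans ((heq_of_eq (StrictSymmMon.tensor_id _ _)).trans ?_)
    exact id_heq (M a b).symm
  | tensor_comp f g f' g' =>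
    refine (eval_tensor o m _ _).trans ((heq_of_eq (StrictSymmMon.tensor_comp _ _ _ _)).trans ?_)
    exact comp_heq' (M _ _).symm (M _ _).symm (M _ _).symm (eval_tensor o m _ _).symm
      (eval_tensor o m _ _).symm
  | tensor_assoc f g h =>
    refine (eval_tensor o m _ _).trans (HEq.trans ?_ (eval_tensor o m _ _).symm)
    refine (tensor_heq (M _ _) (M _ _) rfl rfl (eval_tensor o m _ _) HEq.rfl).trans ?_
    refine (StrictSymmMon.tensor_assoc _ _ _).trans ?_
    exact tensor_heq rfl rfl (M _ _).symm (M _ _).symm HEq.rfl (eval_tensor o m _ _).symm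
  | unit_tensor f =>
    refine (eval_tensor o m _ _).trans ?_
    exact (tensor_heq U U rfl rfl (id_heq U) HEq.rfl).trans (StrictSymmMon.unit_tensor _)
  | tensor_unit f =>
    refine (eval_tensor o m _ _).trans ?_
    exact (tensor_heq rfl rfl U U HEq.rfl (id_heq U)).trans (StrictSymmMon.tensor_unit _)
  | braid_natural f g =>
    refine (comp_heq' (M _ _) (M _ _) (M _ _) (eval_tensor o m _ _) (eval_braid o m _ _)).trans ?_
    refine (heq_of_eq (StrictSymmMon.braid_natural _ _)).trans ?_
    exact (comp_heq' (M _ _) (M _ _) (M _ _) (eval_braid o m _ _) (eval_tensor o m _ _)).symm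
  | braid_braid a b =>
    refine (comp_heq' (M _ _) (M _ _) (M _ _) (eval_braid o m _ _) (eval_braid o m _ _)).trans ?_
    exact (heq_of_eq (StrictSymmMon.braid_braid _ _)).trans (id_heq (M _ _).symm)
  | hexagon a b c =>
    have key : HEq (StrictSymmMon.braid (liftObj o a) (liftObj o (b * c)))
        (StrictSymmMon.braid (liftObj o a) (liftObj o b * liftObj o c)) := by rw [M b c]
    refine (eval_braid o m _ _).trans (key.trans ((StrictSymmMon.hexagon _ _ _).trans ?_))
    have h1 : HEq (StrictSymmMon.tensor (StrictSymmMon.braid (liftObj o a) (liftObj o b))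
        (𝟙 (liftObj o c))) (((Term.braid a b).tensor (Term.id c)).eval o m) :=
      ((eval_tensor o m (Term.braid a b) (Term.id c)).trans
        (tensor_heq (M _ _) (M _ _) rfl rfl (eval_braid o m a b) HEq.rfl)).symm
    have h3 : HEq (StrictSymmMon.tensor (𝟙 (liftObj o b))
        (StrictSymmMon.braid (liftObj o a) (liftObj o c)))
        (((Term.id b).tensor (Term.braid a c)).eval o m) :=
      ((eval_tensor o m (Term.id b) (Term.braid a c)).trans
        (tensor_heq rfl rfl (M _ _) (M _ _) HEq.rfl (eval_braid o m a c))).symm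
    have e1 : liftObj o a * liftObj o b * liftObj o c = liftObj o (a * b * c) := by rw [M, M]
    have e2 : liftObj o b * liftObj o a * liftObj o c = liftObj o (b * a * c) := by rw [M, M]
    have e3 : liftObj o b * (liftObj o a * liftObj o c) = liftObj o (b * (a * c)) := by rw [M, M]
    have e4 : liftObj o b * (liftObj o c * liftObj o a) = liftObj o (b * (c * a)) := by rw [M, M]
    have h2 : HEq (eqToHom (mul_assoc (liftObj o b) (liftObj o a) (liftObj o c)))
        ((Term.ofEq (mul_assoc b a c)).eval o m) := by
      rw [eval_ofEq]
      exact (eqToHom_heq_id _).trans ((id_heq e2).trans (eqToHom_heq_id _).symm)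
    exact comp_heq' e1 e2 e4 h1 (comp_heq' e2 e3 e4 h2 h3)

/-- The strict symmetric monoidal functor determined by its values on places and transitions. -/
def lift : StrictFunctor N.Free D where
  obj a := liftObj o a
  map {a b} f := Quotient.lift (fun f : Term N a b => f.eval o m)
    (fun _ _ h => eq_of_heq (Term.eval_rel o m h)) f
  map_id _ := rfl
  map_comp := by rintro _ _ _ ⟨f⟩ ⟨g⟩; rfl
  obj_one := liftObj_one o
  obj_mul := liftObj_mul o
  map_tensor := by rintro _ _ _ _ ⟨f⟩ ⟨g⟩; exact Term.eval_tensor o m f g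
  map_braid a b := Term.eval_braid o m a b

end lift

/-- The net with the same places and no transitions. -/
def bar (N : PetriNet.{u}) : PetriNet.{u} where
  Place := N.Place
  Trans := PEmpty
  src := PEmpty.elim
  tgt := PEmpty.elim

/-- An inclusion of nets: `M` is, up to the names of its places and transitions, given by some of
the places and some of the transitions of `N`, with the same inputs and outputs. -/
structure Inclusion (M N : PetriNet.{u}) where
  place : M.Place → N.Place
  trans : M.Trans → N.Trans
  place_injective : Function.Injective place
  trans_injective : Function.Injective trans
  src_trans : ∀ t, N.src (trans t) = FreeMonoid.map place (M.src t)
  tgt_trans : ∀ t, N.tgt (trans t) = FreeMonoid.map place (M.tgt t)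

namespace Inclusion

variable {M N : PetriNet.{u}}

theorem liftObj_eq (i : Inclusion M N) (a : M.Free) :
    liftObj (D := N.Free) (fun p => ofPlace (i.place p)) a =
      (FreeMonoid.map i.place a : FreeMonoid N.Place) := by
  change FreeMonoid.lift _ _ = _
  have : FreeMonoid.lift (fun p => FreeMonoid.of (i.place p)) = FreeMonoid.map i.place := by
    ext p; rfl
  exact DFunLike.congr_fun this a

/-- The strict symmetric monoidal functor between free categories induced by an inclusion. -/
def functor (i : Inclusion M N) : StrictFunctor M.Free N.Free :=
  lift (fun p => ofPlace (i.place p)) (fun t =>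
    eqToHom ((i.liftObj_eq _).trans (i.src_trans t).symm) ≫ ofTrans (i.trans t) ≫
      eqToHom ((i.tgt_trans t).trans (i.liftObj_eq _).symm))

end Inclusion

/-- The inclusion of the net without transitions. -/
def barInclusion (N : PetriNet.{u}) : Inclusion N.bar N where
  place := fun p => p
  trans := PEmpty.elim
  place_injective := fun _ _ h => h
  trans_injective := fun t => t.elim
  src_trans := fun t => t.elim
  tgt_trans := fun t => t.elim

/-- The free symmetric strict monoidal category on a net, as an object of `SSMCat`. -/
def free (N : PetriNet.{u}) : SSMCat.{u} := ⟨N.Free⟩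

end PetriNet

/-! ### Nets with semantics, subnets and erasings of generators -/

/-- A Petri net with semantics in `S`. -/
structure NetSem (S : Type u₂) [Category.{v₂} S] [StrictSymmMon S] where
  net : PetriNet.{u}
  sem : StrictFunctor net.Free S

section

variable {S : Type u₂} [Category.{v₂} S] [StrictSymmMon S]

/-- A net with semantics `M` as a subnet of a net with semantics `N`: an inclusion of nets
which is a morphism of nets with semantics. -/
structure Subnet (M N : NetSem.{u} S) extends PetriNet.Inclusion M.net N.net where
  sem_eq : M.sem = toInclusion.functor.comp N.sem

/-- The net with the same places and no transitions, with the restricted semantics. -/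
def NetSem.bar (N : NetSem.{u} S) : NetSem.{u} S where
  net := N.net.bar
  sem := N.net.barInclusion.functor.comp N.sem

/-- The subnet of `N` that has all the places of `N` and no transitions. -/
def NetSem.barSubnet (N : NetSem.{u} S) : Subnet N.bar N where
  toInclusion := N.net.barInclusion
  sem_eq := rfl

/-- The functor between free categories induced by a subnet, as a morphism of `SSMCat`. -/
def Subnet.free {M N : NetSem.{u} S} (i : Subnet M N) : M.net.free ⟶ N.net.free :=
  i.toInclusion.functor

/-- `K` is an erasing of generators of `N` via the subnet `Nw`: `K` is a subnet of `N`, the net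
with the places of `Nw` and no transitions is a subnet of `K`, and the free category on `N` is
the pushout of the free categories on `Nw` and `K` over the free category on the latter. -/
def IsErasing {N Nw K : NetSem.{u} S} (subw : Subnet Nw N) (subK : Subnet K N) : Prop :=
  ∃ k : Subnet Nw.bar K, IsPushout Nw.barSubnet.free k.free subw.free subK.free

end

/-- The terminal symmetric strict monoidal category. -/
def Term1 : Type := PUnit

instance : Category.{0} Term1 where
  Hom _ _ := PUnit
  id _ := ⟨⟩
  comp _ _ := ⟨⟩

instance : StrictSymmMon Term1 where
  mul _ _ := PUnit.unit
  one := PUnit.unit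
  mul_assoc _ _ _ := rfl
  one_mul _ := rfl
  mul_one _ := rfl
  tensor _ _ := ⟨⟩
  tensor_id _ _ := rfl
  tensor_comp _ _ _ _ := rfl
  tensor_assoc _ _ _ := HEq.rfl
  unit_tensor _ := HEq.rfl
  tensor_unit _ := HEq.rfl
  braid _ _ := ⟨⟩
  braid_natural _ _ := rfl
  braid_braid _ _ := rfl
  hexagon _ _ _ := HEq.rfl

/-- A Petri net, as a net with semantics in the terminal category. -/
def PetriNet.trivial (N : PetriNet.{u}) : NetSem.{u} Term1 where
  net := N
  sem :=
    { obj := fun _ => PUnit.unit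
      map := fun _ => PUnit.unit
      obj_one := rfl
      obj_mul := fun _ _ => rfl
      map_tensor := fun _ _ => HEq.rfl
      map_braid := fun _ _ => HEq.rfl }

/-- The same notion for symmetric strict monoidal categories that are free, and hence are
identified with nets: `E`, `Ew`, `EK` are free on nets `M`, `Mw`, `MK`; the functors `Ew ⟶ E` and
`EK ⟶ E` are given by subnets `Mw` and `MK` of `M`; and `MK` is an erasing of generators of `M`
via `Mw`. -/
def IsErasingOfFree {E Ew EK : SSMCat.{u}} (iw : Ew ⟶ E) (iK : EK ⟶ E) : Prop :=
  ∃ (M Mw MK : PetriNet.{u}) (e : M.free ≅ E) (ew : Mw.free ≅ Ew) (eK : MK.free ≅ EK)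
    (a : Subnet Mw.trivial M.trivial) (b : Subnet MK.trivial M.trivial),
    a.free ≫ e.hom = ew.hom ≫ iw ∧ b.free ≫ e.hom = eK.hom ≫ iK ∧ IsErasing a b

/-! ### Tuples -/

/-- The product of a list of sets. -/
def Tup : FreeMonoid (Type u) → Type u
  | [] => PUnit
  | A :: L => A × Tup L

namespace Tup

/-- Concatenation of tuples. -/
def append : ∀ {L L' : FreeMonoid (Type u)}, Tup L → Tup L' → Tup (L * L')
  | [], _, _, y => y
  | _ :: _, _, x, y => (x.1, append x.2 y)

/-- The first part of a concatenated tuple. -/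
def fst : ∀ {L L' : FreeMonoid (Type u)}, Tup (L * L') → Tup L
  | [], _, _ => PUnit.unit
  | _ :: L, L', x => (x.1, fst (L := L) (L' := L') x.2)

/-- The second part of a concatenated tuple. -/
def snd : ∀ {L L' : FreeMonoid (Type u)}, Tup (L * L') → Tup L'
  | [], _, x => x
  | _ :: L, L', x => snd (L := L) (L' := L') x.2

@[simp] theorem fst_append : ∀ {L L' : FreeMonoid (Type u)} (x : Tup L) (y : Tup L'),
    fst (append x y) = x
  | [], _, _, _ => rfl
  | _ :: _, _, x, y => Prod.ext rfl (fst_append x.2 y)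

@[simp] theorem snd_append : ∀ {L L' : FreeMonoid (Type u)} (x : Tup L) (y : Tup L'),
    snd (append x y) = y
  | [], _, _, _ => rfl
  | _ :: _, _, x, y => snd_append x.2 y

@[simp] theorem append_fst_snd : ∀ {L L' : FreeMonoid (Type u)} (x : Tup (L * L')),
    append (fst x) (snd x) = x
  | [], _, _ => rfl
  | _ :: L, L', x => Prod.ext rfl (append_fst_snd (L := L) (L' := L') x.2)

theorem cons_heq {A : Type u} {L L' : FreeMonoid (Type u)} (h : L = L') (a : A) {x : Tup L}
    {x' : Tup L'} (hx : HEq x x') :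
    HEq (show Tup (A :: L) from (a, x)) (show Tup (A :: L') from (a, x')) := by
  subst h; cases hx; rfl

theorem append_assoc : ∀ {L L' L'' : FreeMonoid (Type u)} (x : Tup L) (y : Tup L')
    (z : Tup L''), HEq (append (append x y) z) (append x (append y z))
  | [], _, _, _, _, _ => HEq.rfl
  | _ :: L, L', L'', x, y, z => cons_heq (mul_assoc (G := FreeMonoid (Type u)) L L' L'') x.1
      (append_assoc x.2 y z)

theorem append_unit : ∀ {L : FreeMonoid (Type u)} (x : Tup L),
    HEq (append x (show Tup 1 from PUnit.unit)) x
  | [], _ => HEq.rfl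
  | _ :: L, x => cons_heq (mul_one (M := FreeMonoid (Type u)) L) x.1 (append_unit x.2)

theorem append_inj {L L' : FreeMonoid (Type u)} {x x' : Tup L} {y y' : Tup L'}
    (h : append x y = append x' y') : x = x' ∧ y = y' :=
  ⟨by simpa using congrArg fst h, by simpa using congrArg snd h⟩

end Tup

/-! ### The two semantics -/

/-- The strictification of the symmetric monoidal category of sets and partial functions: objects
are lists of sets, morphisms are partial functions between the products. -/
def SetStar : Type (u + 1) := FreeMonoid (Type u)

namespace SetStar

instance : Monoid SetStar.{u} := inferInstanceAs (Monoid (FreeMonoid (Type u)))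

/-- The product of the sets in a list. -/
def El (L : SetStar.{u}) : Type u := Tup L

/-- The element of the empty product. -/
def unit : El (1 : SetStar.{u}) := PUnit.unit

/-- Concatenation of tuples, identifying the product of `El L` and `El L'` with `El (L * L')`. -/
def pair {L L' : SetStar.{u}} (x : El L) (y : El L') : El (L * L') := Tup.append x y

theorem unit_unique (x : El (1 : SetStar.{u})) : x = unit := rfl

theorem exists_pair {L L' : SetStar.{u}} (x : El (L * L')) :
    ∃ (y : El L) (z : El L'), x = pair y z :=
  ⟨Tup.fst x, Tup.snd x, (Tup.append_fst_snd x).symm⟩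

theorem pair_inj {L L' : SetStar.{u}} {x x' : El L} {y y' : El L'}
    (h : pair x y = pair x' y') : x = x' ∧ y = y' := Tup.append_inj h

theorem pair_assoc {L L' L'' : SetStar.{u}} (x : El L) (y : El L') (z : El L'') :
    HEq (pair (pair x y) z) (pair x (pair y z)) := Tup.append_assoc x y z

theorem unit_pair {L : SetStar.{u}} (x : El L) : HEq (pair unit x) x := HEq.rfl

theorem pair_unit {L : SetStar.{u}} (x : El L) : HEq (pair x unit) x := Tup.append_unit x

/-- The first part of a tuple. -/
def fst {L L' : SetStar.{u}} (x : El (L * L')) : El L := Tup.fst x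

/-- The second part of a tuple. -/
def snd {L L' : SetStar.{u}} (x : El (L * L')) : El L' := Tup.snd x

@[simp] theorem fst_pair {L L' : SetStar.{u}} (x : El L) (y : El L') : fst (pair x y) = x :=
  Tup.fst_append x y

@[simp] theorem snd_pair {L L' : SetStar.{u}} (x : El L) (y : El L') : snd (pair x y) = y :=
  Tup.snd_append x y

@[simp] theorem pair_fst_snd {L L' : SetStar.{u}} (x : El (L * L')) : pair (fst x) (snd x) = x :=
  Tup.append_fst_snd x

instance : Category.{u} SetStar.{u} where
  Hom L L' := El L →. El L'
  id L := PFun.id (El L)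
  comp f g := PFun.comp g f
  id_comp f := PFun.comp_id f
  comp_id f := PFun.id_comp f
  assoc f g h := (PFun.comp_assoc h g f).symm

/-- `f` is defined at `x` with value `y`. -/
def Maps {L L' : SetStar.{u}} (f : L ⟶ L') (x : El L) (y : El L') : Prop :=
  y ∈ (show El L →. El L' from f) x

theorem hom_ext {L L' : SetStar.{u}} {f g : L ⟶ L'} (h : ∀ x y, Maps f x y ↔ Maps g x y) :
    f = g :=
  PFun.ext h

theorem maps_id {L : SetStar.{u}} {x y : El L} : Maps (𝟙 L) x y ↔ y = x := Part.mem_some_iff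

theorem maps_comp {L L' L'' : SetStar.{u}} {f : L ⟶ L'} {g : L' ⟶ L''} {x : El L} {z : El L''} :
    Maps (f ≫ g) x z ↔ ∃ y, Maps f x y ∧ Maps g y z := Part.mem_bind_iff

/-- The product of two partial functions. -/
def tensorHom {L₁ L₁' L₂ L₂' : SetStar.{u}} (f : L₁ ⟶ L₁') (g : L₂ ⟶ L₂') :
    L₁ * L₂ ⟶ L₁' * L₂' :=
  show El (L₁ * L₂) →. El (L₁' * L₂') from fun x =>
    ((show El L₁ →. El L₁' from f) (fst x)).bind fun a =>
      ((show El L₂ →. El L₂' from g) (snd x)).map fun b => pair a b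

theorem maps_tensor {L₁ L₁' L₂ L₂' : SetStar.{u}} {f : L₁ ⟶ L₁'} {g : L₂ ⟶ L₂'}
    {x : El L₁} {y : El L₂} {x' : El L₁'} {y' : El L₂'} :
    Maps (tensorHom f g) (pair x y) (pair x' y') ↔ Maps f x x' ∧ Maps g y y' := by
  refine Part.mem_bind_iff.trans ⟨?_, ?_⟩
  · rintro ⟨a, ha, h⟩
    obtain ⟨b, hb, h⟩ := (Part.mem_map_iff _).1 h
    obtain ⟨rfl, rfl⟩ := pair_inj h
    rw [fst_pair] at ha
    rw [snd_pair] at hb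
    exact ⟨ha, hb⟩
  · rintro ⟨ha, hb⟩
    refine ⟨x', ?_, (Part.mem_map_iff _).2 ⟨y', ?_, rfl⟩⟩
    · rw [fst_pair]; exact ha
    · rw [snd_pair]; exact hb

/-- The exchange of the two parts of a tuple. -/
def braidHom (L L' : SetStar.{u}) : L * L' ⟶ L' * L :=
  show El (L * L') →. El (L' * L) from fun x => Part.some (pair (snd x) (fst x))

theorem maps_braid {L L' : SetStar.{u}} {x : El L} {y : El L'} {z : El (L' * L)} :
    Maps (braidHom L L') (pair x y) z ↔ z = pair y x := by
  refine Part.mem_some_iff.trans ?_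
  rw [fst_pair, snd_pair]

theorem maps_eqToHom {L L' : SetStar.{u}} (h : L = L') {x : El L} {y : El L'} :
    Maps (eqToHom h) x y ↔ HEq x y := by
  subst h
  exact maps_id.trans ⟨fun h => heq_of_eq h.symm, fun h => (eq_of_heq h).symm⟩

theorem hom_heq {L₁ L₂ L₁' L₂' : SetStar.{u}} (h₁ : L₁ = L₁') (h₂ : L₂ = L₂') {f : L₁ ⟶ L₂}
    {f' : L₁' ⟶ L₂'}
    (h : ∀ x y x' y', HEq x x' → HEq y y' → (Maps f x y ↔ Maps f' x' y')) : HEq f f' := by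
  subst h₁ h₂
  exact heq_of_eq (hom_ext fun x y => h x y x y HEq.rfl HEq.rfl)

theorem maps_congr {L₁ L₂ L₁' L₂' : SetStar.{u}} (h₁ : L₁ = L₁') (h₂ : L₂ = L₂') {f : L₁ ⟶ L₂}
    {f' : L₁' ⟶ L₂'} (hf : HEq f f') {x : El L₁} {x' : El L₁'} {y : El L₂} {y' : El L₂'}
    (hx : HEq x x') (hy : HEq y y') : Maps f x y ↔ Maps f' x' y' := by
  subst h₁ h₂; cases hf; cases hx; cases hy; rfl

instance : StrictSymmMon SetStar.{u} where
  tensor f g := tensorHom f g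
  tensor_id L L' := hom_ext fun x y => by
    obtain ⟨x₁, x₂, rfl⟩ := exists_pair x
    obtain ⟨y₁, y₂, rfl⟩ := exists_pair y
    rw [maps_tensor, maps_id, maps_id, maps_id]
    exact ⟨fun h => by rw [h.1, h.2], fun h => pair_inj h⟩
  tensor_comp f g f' g' := hom_ext fun x y => by
    obtain ⟨x₁, x₂, rfl⟩ := exists_pair x
    obtain ⟨y₁, y₂, rfl⟩ := exists_pair y
    rw [maps_tensor, maps_comp, maps_comp, maps_comp]
    constructor
    · rintro ⟨⟨z, h, h'⟩, z', k, k'⟩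
      exact ⟨pair z z', maps_tensor.2 ⟨h, k⟩, maps_tensor.2 ⟨h', k'⟩⟩
    · rintro ⟨z, h, h'⟩
      obtain ⟨z₁, z₂, rfl⟩ := exists_pair z
      rw [maps_tensor] at h h'
      exact ⟨⟨z₁, h.1, h'.1⟩, z₂, h.2, h'.2⟩
  tensor_assoc f g h := hom_heq (mul_assoc _ _ _) (mul_assoc _ _ _) fun x y x' y' hx hy => by
    obtain ⟨x, x₃, rfl⟩ := exists_pair x
    obtain ⟨x₁, x₂, rfl⟩ := exists_pair x
    obtain ⟨y, y₃, rfl⟩ := exists_pair y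
    obtain ⟨y₁, y₂, rfl⟩ := exists_pair y
    obtain rfl := eq_of_heq ((pair_assoc _ _ _).symm.trans hx)
    obtain rfl := eq_of_heq ((pair_assoc _ _ _).symm.trans hy)
    rw [maps_tensor, maps_tensor, maps_tensor, maps_tensor, and_assoc]
  unit_tensor f := by
    refine hom_heq (one_mul _) (one_mul _) fun x y x' y' hx hy => ?_
    cases hx; cases hy
    refine (maps_tensor (f := 𝟙 (1 : SetStar.{u})) (g := f) (x := unit)
      (x' := unit)).trans ?_
    exact ⟨fun h => h.2, fun h => ⟨maps_id.2 rfl, h⟩⟩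
  tensor_unit {L L'} f := by
    refine hom_heq (mul_one _) (mul_one _) fun x y x' y' hx hy => ?_
    obtain ⟨x₁, x₂, rfl⟩ := exists_pair (L := L) (L' := 1) x
    obtain ⟨y₁, y₂, rfl⟩ := exists_pair (L := L') (L' := 1) y
    obtain rfl := eq_of_heq ((pair_unit _).symm.trans hx)
    obtain rfl := eq_of_heq ((pair_unit _).symm.trans hy)
    refine maps_tensor.trans ?_
    exact ⟨fun h => h.1, fun h => ⟨h, maps_id.2 rfl⟩⟩
  braid L L' := braidHom L L'
  braid_natural f g := hom_ext fun x y => by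
    obtain ⟨x₁, x₂, rfl⟩ := exists_pair x
    obtain ⟨y₁, y₂, rfl⟩ := exists_pair y
    rw [maps_comp, maps_comp]
    constructor
    · rintro ⟨z, h, h'⟩
      obtain ⟨z₁, z₂, rfl⟩ := exists_pair z
      rw [maps_tensor] at h
      rw [maps_braid] at h'
      obtain ⟨rfl, rfl⟩ := pair_inj h'
      exact ⟨_, maps_braid.2 rfl, maps_tensor.2 ⟨h.2, h.1⟩⟩
    · rintro ⟨z, h, h'⟩
      rw [maps_braid] at h
      subst h
      rw [maps_tensor] at h'
      exact ⟨_, maps_tensor.2 ⟨h'.2, h'.1⟩, maps_braid.2 rfl⟩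
  braid_braid L L' := hom_ext fun x y => by
    obtain ⟨x₁, x₂, rfl⟩ := exists_pair x
    rw [maps_comp, maps_id]
    constructor
    · rintro ⟨z, h, h'⟩
      rw [maps_braid] at h
      subst h
      exact maps_braid.1 h'
    · rintro rfl
      exact ⟨_, maps_braid.2 rfl, maps_braid.2 rfl⟩
  hexagon a b c := by
    refine hom_heq (mul_assoc _ _ _).symm (mul_assoc _ _ _) fun x y x' y' hx hy => ?_
    obtain ⟨x, x₃, rfl⟩ := exists_pair x'
    obtain ⟨x₁, x₂, rfl⟩ := exists_pair x
    obtain rfl := eq_of_heq (hx.trans (pair_assoc _ _ _))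
    rw [maps_braid, maps_comp]
    constructor
    · rintro rfl
      refine ⟨pair (pair x₂ x₁) x₃,
        maps_tensor.2 ⟨maps_braid.2 rfl, maps_id.2 rfl⟩, ?_⟩
      rw [maps_comp]
      refine ⟨pair x₂ (pair x₁ x₃), (maps_eqToHom _).2 (pair_assoc _ _ _), ?_⟩
      obtain rfl := eq_of_heq ((pair_assoc _ _ _).symm.trans hy)
      exact maps_tensor.2 ⟨maps_id.2 rfl, maps_braid.2 rfl⟩
    · rintro ⟨z, h, h'⟩
      obtain ⟨z, z₃, rfl⟩ := exists_pair z
      rw [maps_tensor, maps_braid, maps_id] at h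
      obtain ⟨rfl, rfl⟩ := h
      rw [maps_comp] at h'
      obtain ⟨t, h, h'⟩ := h'
      obtain rfl := eq_of_heq (((maps_eqToHom _).1 h).symm.trans (pair_assoc _ _ _))
      obtain ⟨y₁, y₂, rfl⟩ := exists_pair y'
      rw [maps_tensor, maps_braid, maps_id] at h'
      obtain ⟨rfl, rfl⟩ := h'
      exact eq_of_heq (hy.trans (pair_assoc _ _ _).symm)

end SetStar

/-- A span `A ← apex → B` of sets. -/
structure Spn (A B : Type u) : Type (u + 1) where
  apex : Type u
  left : apex → A
  right : apex → B

namespace Spn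

variable {A B C D : Type u}

/-- An isomorphism of spans. -/
structure Iso (S T : Spn A B) extends S.apex ≃ T.apex where
  left_eq : ∀ s, T.left (toFun s) = S.left s
  right_eq : ∀ s, T.right (toFun s) = S.right s

instance setoid (A B : Type u) : Setoid (Spn A B) where
  r S T := Nonempty (Iso S T)
  iseqv :=
    { refl := fun S => ⟨⟨Equiv.refl _, fun _ => rfl, fun _ => rfl⟩⟩
      symm := fun ⟨e⟩ => ⟨⟨e.toEquiv.symm,
        fun t => by
          rw [← e.left_eq]; exact congrArg _ (e.toEquiv.apply_symm_apply t),
        fun t => by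
          rw [← e.right_eq]; exact congrArg _ (e.toEquiv.apply_symm_apply t)⟩⟩
      trans := fun ⟨e⟩ ⟨e'⟩ => ⟨⟨e.toEquiv.trans e'.toEquiv,
        fun s => (e'.left_eq _).trans (e.left_eq s),
        fun s => (e'.right_eq _).trans (e.right_eq s)⟩⟩ }

/-- The graph of a function. -/
def ofFun (φ : A → B) : Spn A B := ⟨A, fun a => a, φ⟩

/-- The composite of spans, by pullback. -/
def comp (S : Spn A B) (T : Spn B C) : Spn A C where
  apex := {p : S.apex × T.apex // S.right p.1 = T.left p.2}
  left p := S.left p.1.1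
  right p := T.right p.1.2

/-- The span whose apex has the fibre `W a b` over the pair `(a, b)`. -/
def ofFamily (W : A → B → Type u) : Spn A B where
  apex := Σ (a : A) (b : B), W a b
  left p := p.1
  right p := p.2.1

theorem comp_congr {S S' : Spn A B} {T T' : Spn B C} (h : S ≈ S') (h' : T ≈ T') :
    S.comp T ≈ S'.comp T' := by
  obtain ⟨e⟩ := h
  obtain ⟨e'⟩ := h'
  exact ⟨⟨(e.toEquiv.prodCongr e'.toEquiv).subtypeEquiv fun p => by
    rw [← e.right_eq, ← e'.left_eq]; rfl, fun s => e.left_eq _, fun s => e'.right_eq _⟩⟩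

end Spn

/-- The strictification of the symmetric monoidal category of sets and isomorphism classes of
spans: objects are lists of sets, morphisms are isomorphism classes of spans between the
products. -/
def SpanCat : Type (u + 1) := FreeMonoid (Type u)

namespace SpanCat

instance : Monoid SpanCat.{u} := inferInstanceAs (Monoid (FreeMonoid (Type u)))

/-- The product of the sets in a list. -/
def El (L : SpanCat.{u}) : Type u := Tup L

/-- The element of the empty product. -/
def unit : El (1 : SpanCat.{u}) := PUnit.unit

/-- Concatenation of tuples, identifying the product of `El L` and `El L'` with `El (L * L')`. -/
def pair {L L' : SpanCat.{u}} (x : El L) (y : El L') : El (L * L') := Tup.append x y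

theorem unit_unique (x : El (1 : SpanCat.{u})) : x = unit := rfl

theorem exists_pair {L L' : SpanCat.{u}} (x : El (L * L')) :
    ∃ (y : El L) (z : El L'), x = pair y z :=
  ⟨Tup.fst x, Tup.snd x, (Tup.append_fst_snd x).symm⟩

theorem pair_inj {L L' : SpanCat.{u}} {x x' : El L} {y y' : El L'}
    (h : pair x y = pair x' y') : x = x' ∧ y = y' := Tup.append_inj h

theorem pair_assoc {L L' L'' : SpanCat.{u}} (x : El L) (y : El L') (z : El L'') :
    HEq (pair (pair x y) z) (pair x (pair y z)) := Tup.append_assoc x y z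

theorem unit_pair {L : SpanCat.{u}} (x : El L) : HEq (pair unit x) x := HEq.rfl

theorem pair_unit {L : SpanCat.{u}} (x : El L) : HEq (pair x unit) x := Tup.append_unit x

/-- The first part of a tuple. -/
def fst {L L' : SpanCat.{u}} (x : El (L * L')) : El L := Tup.fst x

/-- The second part of a tuple. -/
def snd {L L' : SpanCat.{u}} (x : El (L * L')) : El L' := Tup.snd x

@[simp] theorem fst_pair {L L' : SpanCat.{u}} (x : El L) (y : El L') : fst (pair x y) = x :=
  Tup.fst_append x y

@[simp] theorem snd_pair {L L' : SpanCat.{u}} (x : El L) (y : El L') : snd (pair x y) = y :=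
  Tup.snd_append x y

@[simp] theorem pair_fst_snd {L L' : SpanCat.{u}} (x : El (L * L')) : pair (fst x) (snd x) = x :=
  Tup.append_fst_snd x

instance : Category.{u + 1} SpanCat.{u} where
  Hom L L' := Quotient (Spn.setoid (El L) (El L'))
  id L := Quotient.mk _ (Spn.ofFun fun x => x)
  comp f g := Quotient.map₂ Spn.comp (fun _ _ h _ _ h' => Spn.comp_congr h h') f g
  id_comp := by
    rintro L L' ⟨S⟩
    exact Quotient.sound ⟨⟨
      { toFun := fun p => p.1.2
        invFun := fun s => ⟨(S.left s, s), rfl⟩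
        left_inv := fun p => Subtype.ext (Prod.ext p.2.symm rfl)
        right_inv := fun s => rfl }, fun p => p.2.symm, fun p => rfl⟩⟩
  comp_id := by
    rintro L L' ⟨S⟩
    exact Quotient.sound ⟨⟨
      { toFun := fun p => p.1.1
        invFun := fun s => ⟨(s, S.right s), rfl⟩
        left_inv := fun p => Subtype.ext (Prod.ext rfl p.2)
        right_inv := fun s => rfl }, fun p => rfl, fun p => p.2⟩⟩
  assoc := by
    rintro L₁ L₂ L₃ L₄ ⟨S⟩ ⟨T⟩ ⟨U⟩
    exact Quotient.sound ⟨⟨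
      { toFun := fun p => ⟨(p.1.1.1.1, ⟨(p.1.1.1.2, p.1.2), p.2⟩), p.1.1.2⟩
        invFun := fun p => ⟨(⟨(p.1.1, p.1.2.1.1), p.2⟩, p.1.2.1.2), p.1.2.2⟩
        left_inv := fun _ => rfl
        right_inv := fun _ => rfl }, fun _ => rfl, fun _ => rfl⟩⟩

/-- The morphism represented by a span. -/
def mk {L L' : SpanCat.{u}} (S : Spn (El L) (El L')) : L ⟶ L' := Quotient.mk _ S

theorem mk_surjective {L L' : SpanCat.{u}} (f : L ⟶ L') : ∃ S, f = mk S :=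
  ⟨Quotient.out f, (Quotient.out_eq f).symm⟩

theorem mk_eq {L L' : SpanCat.{u}} {S T : Spn (El L) (El L')} (e : Spn.Iso S T) : mk S = mk T :=
  Quotient.sound ⟨e⟩

theorem mk_eq_iff {L L' : SpanCat.{u}} {S T : Spn (El L) (El L')} :
    mk S = mk T ↔ Nonempty (Spn.Iso S T) := Quotient.eq

theorem mk_comp {L L' L'' : SpanCat.{u}} (S : Spn (El L) (El L')) (T : Spn (El L') (El L'')) :
    mk S ≫ mk T = mk (S.comp T) := rfl

theorem id_eq (L : SpanCat.{u}) : 𝟙 L = mk (Spn.ofFun fun x => x) := rfl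

/-- The product of two spans, as a span between products of concatenated lists. -/
def tensorSpn {L₁ L₁' L₂ L₂' : SpanCat.{u}} (S : Spn (El L₁) (El L₁'))
    (T : Spn (El L₂) (El L₂')) : Spn (El (L₁ * L₂)) (El (L₁' * L₂')) where
  apex := S.apex × T.apex
  left p := pair (S.left p.1) (T.left p.2)
  right p := pair (S.right p.1) (T.right p.2)

theorem tensorSpn_congr {L₁ L₁' L₂ L₂' : SpanCat.{u}} {S S' : Spn (El L₁) (El L₁')}
    {T T' : Spn (El L₂) (El L₂')} (h : S ≈ S') (h' : T ≈ T') :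
    tensorSpn S T ≈ tensorSpn S' T' := by
  obtain ⟨e⟩ := h
  obtain ⟨e'⟩ := h'
  exact ⟨⟨e.toEquiv.prodCongr e'.toEquiv,
    fun p => congrArg₂ pair (e.left_eq _) (e'.left_eq _),
    fun p => congrArg₂ pair (e.right_eq _) (e'.right_eq _)⟩⟩

/-- The product of two isomorphism classes of spans. -/
def tensorHom {L₁ L₁' L₂ L₂' : SpanCat.{u}} (f : L₁ ⟶ L₁') (g : L₂ ⟶ L₂') :
    L₁ * L₂ ⟶ L₁' * L₂' :=
  Quotient.map₂ tensorSpn (fun _ _ h _ _ h' => tensorSpn_congr h h') f g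

theorem mk_tensor {L₁ L₁' L₂ L₂' : SpanCat.{u}} (S : Spn (El L₁) (El L₁'))
    (T : Spn (El L₂) (El L₂')) : tensorHom (mk S) (mk T) = mk (tensorSpn S T) := rfl

/-- The exchange of the two parts of a tuple. -/
def swap {L L' : SpanCat.{u}} (x : El (L * L')) : El (L' * L) := pair (snd x) (fst x)

theorem swap_pair {L L' : SpanCat.{u}} (x : El L) (y : El L') : swap (pair x y) = pair y x := by
  rw [swap, fst_pair, snd_pair]

theorem swap_swap {L L' : SpanCat.{u}} (x : El (L * L')) : swap (swap x) = x := by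
  obtain ⟨x₁, x₂, rfl⟩ := exists_pair x
  rw [swap_pair, swap_pair]

theorem mk_heq {L₁ L₂ L₁' L₂' : SpanCat.{u}} (h₁ : L₁ = L₁') (h₂ : L₂ = L₂')
    {S : Spn (El L₁) (El L₂)} {S' : Spn (El L₁') (El L₂')} (e : S.apex ≃ S'.apex)
    (hl : ∀ s, HEq (S'.left (e s)) (S.left s)) (hr : ∀ s, HEq (S'.right (e s)) (S.right s)) :
    HEq (mk S) (mk S') := by
  subst h₁ h₂
  exact heq_of_eq (mk_eq ⟨e, fun s => eq_of_heq (hl s), fun s => eq_of_heq (hr s)⟩)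

theorem ofFun_heq {L₁ L₂ L₁' L₂' : SpanCat.{u}} (h₁ : L₁ = L₁') (h₂ : L₂ = L₂')
    {φ : El L₁ → El L₂} {φ' : El L₁' → El L₂'} (h : ∀ x x', HEq x x' → HEq (φ x) (φ' x')) :
    HEq (mk (Spn.ofFun φ)) (mk (Spn.ofFun φ')) := by
  subst h₁ h₂
  obtain rfl : φ = φ' := funext fun x => eq_of_heq (h x x HEq.rfl)
  rfl

theorem ofFun_comp {L L' L'' : SpanCat.{u}} (φ : El L → El L') (ψ : El L' → El L'') :
    mk (Spn.ofFun φ) ≫ mk (Spn.ofFun ψ) = mk (Spn.ofFun fun x => ψ (φ x)) := by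
  rw [mk_comp]
  exact mk_eq ⟨
    { toFun := fun p => p.1.1
      invFun := fun x => ⟨(x, φ x), rfl⟩
      left_inv := fun p => Subtype.ext (Prod.ext rfl p.2)
      right_inv := fun x => rfl }, fun p => rfl, fun p => congrArg ψ p.2⟩

theorem ofFun_tensor {L₁ L₁' L₂ L₂' : SpanCat.{u}} (φ : El L₁ → El L₁') (ψ : El L₂ → El L₂') :
    tensorHom (mk (Spn.ofFun φ)) (mk (Spn.ofFun ψ)) =
      mk (Spn.ofFun fun x => pair (φ (fst x)) (ψ (snd x))) := by
  rw [mk_tensor]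
  exact mk_eq ⟨
    { toFun := fun p => pair p.1 p.2
      invFun := fun x => (fst x, snd x)
      left_inv := fun p => Prod.ext (fst_pair _ _) (snd_pair _ _)
      right_inv := fun x => pair_fst_snd x }, fun p => rfl,
    fun p => congrArg₂ pair (congrArg φ (fst_pair p.1 p.2)) (congrArg ψ (snd_pair p.1 p.2))⟩

theorem ofFun_eqToHom {L L' : SpanCat.{u}} (h : L = L') :
    eqToHom h = mk (Spn.ofFun fun x => cast (congrArg El h) x) := by
  subst h; rfl

instance : StrictSymmMon SpanCat.{u} where
  tensor f g := tensorHom f g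
  tensor_id L L' := by
    rw [id_eq, id_eq, ofFun_tensor, id_eq]
    simp only [pair_fst_snd]
  tensor_comp f g f' g' := by
    obtain ⟨S, rfl⟩ := mk_surjective f
    obtain ⟨T, rfl⟩ := mk_surjective g
    obtain ⟨S', rfl⟩ := mk_surjective f'
    obtain ⟨T', rfl⟩ := mk_surjective g'
    rw [mk_comp, mk_comp, mk_tensor, mk_tensor, mk_tensor, mk_comp]
    exact mk_eq ⟨
      { toFun := fun p => ⟨((p.1.1.1, p.2.1.1), (p.1.1.2, p.2.1.2)), congrArg₂ pair p.1.2 p.2.2⟩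
        invFun := fun p => (⟨(p.1.1.1, p.1.2.1), (pair_inj p.2).1⟩,
          ⟨(p.1.1.2, p.1.2.2), (pair_inj p.2).2⟩)
        left_inv := fun _ => rfl
        right_inv := fun _ => rfl }, fun _ => rfl, fun _ => rfl⟩
  tensor_assoc f g h := by
    obtain ⟨S, rfl⟩ := mk_surjective f
    obtain ⟨T, rfl⟩ := mk_surjective g
    obtain ⟨U, rfl⟩ := mk_surjective h
    rw [mk_tensor, mk_tensor, mk_tensor, mk_tensor]
    exact mk_heq (mul_assoc _ _ _) (mul_assoc _ _ _) (Equiv.prodAssoc _ _ _)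
      (fun s => (pair_assoc _ _ _).symm) (fun s => (pair_assoc _ _ _).symm)
  unit_tensor f := by
    obtain ⟨S, rfl⟩ := mk_surjective f
    rw [id_eq, mk_tensor]
    exact mk_heq (one_mul _) (one_mul _)
      { toFun := fun p => p.2
        invFun := fun s => (unit, s)
        left_inv := fun _ => rfl
        right_inv := fun _ => rfl } (fun s => HEq.rfl) (fun s => HEq.rfl)
  tensor_unit f := by
    obtain ⟨S, rfl⟩ := mk_surjective f
    rw [id_eq, mk_tensor]
    exact mk_heq (mul_one _) (mul_one _)
      { toFun := fun p => p.1
        invFun := fun s => (s, unit)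
        left_inv := fun _ => rfl
        right_inv := fun _ => rfl } (fun s => (pair_unit _).symm) (fun s => (pair_unit _).symm)
  braid L L' := mk (Spn.ofFun swap)
  braid_natural f g := by
    obtain ⟨S, rfl⟩ := mk_surjective f
    obtain ⟨T, rfl⟩ := mk_surjective g
    rw [mk_tensor, mk_tensor, mk_comp, mk_comp]
    exact mk_eq ⟨
      { toFun := fun p => ⟨(pair (S.left p.1.1.1) (T.left p.1.1.2), (p.1.1.2, p.1.1.1)),
          swap_pair _ _⟩
        invFun := fun p => ⟨((p.1.2.2, p.1.2.1), pair (S.right p.1.2.2) (T.right p.1.2.1)), rfl⟩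
        left_inv := fun p => Subtype.ext (Prod.ext rfl p.2)
        right_inv := fun p => Subtype.ext (Prod.ext
          (((swap_pair _ _).symm.trans (congrArg swap p.2).symm).trans (swap_swap _)) rfl) },
      fun _ => rfl, fun p => (swap_pair _ _).symm.trans (congrArg swap p.2)⟩
  braid_braid L L' := by
    rw [ofFun_comp, id_eq]
    simp only [swap_swap]
  hexagon a b c := by
    rw [ofFun_eqToHom, id_eq, id_eq, ofFun_tensor, ofFun_tensor, ofFun_comp, ofFun_comp]
    refine ofFun_heq (mul_assoc _ _ _).symm (mul_assoc _ _ _) fun x x' hx => ?_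
    obtain ⟨x, x₃, rfl⟩ := exists_pair x'
    obtain ⟨x₁, x₂, rfl⟩ := exists_pair x
    obtain rfl := eq_of_heq (hx.trans (pair_assoc _ _ _))
    rw [fst_pair, snd_pair, swap_pair, swap_pair]
    have e : cast (congrArg El (mul_assoc b a c)) (pair (pair x₂ x₁) x₃) =
        pair x₂ (pair x₁ x₃) := eq_of_heq ((cast_heq _ _).trans (pair_assoc _ _ _))
    rw [e, fst_pair, snd_pair, swap_pair]
    exact pair_assoc _ _ _

end SpanCat

/-! ### The Grothendieck construction

The two kinds of semantics are treated together: a system of elements assigns a set to every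
object, and a system of witnesses assigns to every morphism `f : X ⟶ Y` and all elements `x` of
`X` and `y` of `Y` the set of ways in which `f` leads from `x` to `y`. -/

/-- Sets of elements of the objects of a symmetric strict monoidal category, with pairing. -/
structure Elements (C : Type u₁) [Monoid C] where
  El : C → Type w
  unit : El 1
  pair : ∀ {X Y : C}, El X → El Y → El (X * Y)
  pair_assoc : ∀ {X Y Z : C} (x : El X) (y : El Y) (z : El Z),
    HEq (pair (pair x y) z) (pair x (pair y z))
  unit_pair : ∀ {X : C} (x : El X), HEq (pair unit x) x
  pair_unit : ∀ {X : C} (x : El X), HEq (pair x unit) x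

/-- Sets of witnesses, with what is needed to compose and to multiply them. -/
structure Witnesses {C : Type u₁} [Category.{v₁} C] [StrictSymmMon C] (E : Elements.{w} C) where
  Wit : ∀ {X Y : C}, (X ⟶ Y) → E.El X → E.El Y → Type v
  id : ∀ {X : C} (x : E.El X), Wit (𝟙 X) x x
  comp : ∀ {X Y Z : C} {f : X ⟶ Y} {g : Y ⟶ Z} {x : E.El X} {y : E.El Y} {z : E.El Z},
    Wit f x y → Wit g y z → Wit (f ≫ g) x z
  tensor : ∀ {X Y X' Y' : C} {f : X ⟶ Y} {g : X' ⟶ Y'} {x : E.El X} {y : E.El Y}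
    {x' : E.El X'} {y' : E.El Y'},
    Wit f x y → Wit g x' y' → Wit (StrictSymmMon.tensor f g) (E.pair x x') (E.pair y y')
  braid : ∀ {X Y : C} (x : E.El X) (y : E.El Y),
    Wit (StrictSymmMon.braid X Y) (E.pair x y) (E.pair y x)
  id_subsingleton : ∀ {X : C} (x y : E.El X), Subsingleton (Wit (𝟙 X) x y)
  braid_subsingleton : ∀ {X Y : C} (x : E.El (X * Y)) (y : E.El (Y * X)),
    Subsingleton (Wit (StrictSymmMon.braid X Y) x y)
  id_comp : ∀ {X Y : C} {f : X ⟶ Y} {x : E.El X} {y : E.El Y} (s : Wit f x y),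
    HEq (comp (id x) s) s
  comp_id : ∀ {X Y : C} {f : X ⟶ Y} {x : E.El X} {y : E.El Y} (s : Wit f x y),
    HEq (comp s (id y)) s
  assoc : ∀ {X Y Z T : C} {f : X ⟶ Y} {g : Y ⟶ Z} {h : Z ⟶ T} {x : E.El X} {y : E.El Y}
    {z : E.El Z} {t : E.El T} (r : Wit f x y) (s : Wit g y z) (q : Wit h z t),
    HEq (comp (comp r s) q) (comp r (comp s q))
  tensor_comp : ∀ {X Y Z X' Y' Z' : C} {f : X ⟶ Y} {g : Y ⟶ Z} {f' : X' ⟶ Y'} {g' : Y' ⟶ Z'}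
    {x : E.El X} {y : E.El Y} {z : E.El Z} {x' : E.El X'} {y' : E.El Y'} {z' : E.El Z'}
    (s : Wit f x y) (t : Wit g y z) (s' : Wit f' x' y') (t' : Wit g' y' z'),
    HEq (tensor (comp s t) (comp s' t')) (comp (tensor s s') (tensor t t'))
  tensor_assoc : ∀ {X Y Z X' Y' Z' : C} {f : X ⟶ X'} {g : Y ⟶ Y'} {h : Z ⟶ Z'}
    {x : E.El X} {y : E.El Y} {z : E.El Z} {x' : E.El X'} {y' : E.El Y'} {z' : E.El Z'}
    (r : Wit f x x') (s : Wit g y y') (t : Wit h z z'),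
    HEq (tensor (tensor r s) t) (tensor r (tensor s t))
  unit_tensor : ∀ {X Y : C} {f : X ⟶ Y} {x : E.El X} {y : E.El Y} (s : Wit f x y),
    HEq (tensor (id E.unit) s) s
  tensor_unit : ∀ {X Y : C} {f : X ⟶ Y} {x : E.El X} {y : E.El Y} (s : Wit f x y),
    HEq (tensor s (id E.unit)) s
  braid_natural : ∀ {X Y X' Y' : C} {f : X ⟶ Y} {g : X' ⟶ Y'} {x : E.El X} {y : E.El Y}
    {x' : E.El X'} {y' : E.El Y'} (s : Wit f x y) (t : Wit g x' y'),
    HEq (comp (tensor s t) (braid y y')) (comp (braid x x') (tensor t s))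

section Total

variable {C : Type u₁} [Category.{v₁} C] [StrictSymmMon C] {E : Elements.{w} C}

namespace Witnesses

variable (W : Witnesses.{v} E)

theorem wit_congr {X Y X' Y' : C} (hX : X = X') (hY : Y = Y') {f : X ⟶ Y} {f' : X' ⟶ Y'}
    (hf : HEq f f') {x : E.El X} {y : E.El Y} {x' : E.El X'} {y' : E.El Y'} (hx : HEq x x')
    (hy : HEq y y') : W.Wit f x y = W.Wit f' x' y' := by
  subst hX hY; cases hf; cases hx; cases hy; rfl

theorem comp_heq {X Y Z X' Y' Z' : C} (hX : X = X') (hY : Y = Y') (hZ : Z = Z') {f : X ⟶ Y}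
    {f' : X' ⟶ Y'} (hf : HEq f f') {g : Y ⟶ Z} {g' : Y' ⟶ Z'} (hg : HEq g g')
    {x : E.El X} {y : E.El Y} {z : E.El Z} {x' : E.El X'} {y' : E.El Y'} {z' : E.El Z'}
    (hx : HEq x x') (hy : HEq y y') (hz : HEq z z') {s : W.Wit f x y} {t : W.Wit g y z}
    {s' : W.Wit f' x' y'} {t' : W.Wit g' y' z'} (hs : HEq s s') (ht : HEq t t') :
    HEq (W.comp s t) (W.comp s' t') := by
  subst hX hY hZ; cases hf; cases hg; cases hx; cases hy; cases hz; cases hs; cases ht; rfl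

theorem tensor_heq {X Y Z T X' Y' Z' T' : C} (hX : X = X') (hY : Y = Y') (hZ : Z = Z')
    (hT : T = T') {f : X ⟶ Y} {f' : X' ⟶ Y'} (hf : HEq f f') {g : Z ⟶ T} {g' : Z' ⟶ T'}
    (hg : HEq g g') {x : E.El X} {y : E.El Y} {z : E.El Z} {t : E.El T} {x' : E.El X'}
    {y' : E.El Y'} {z' : E.El Z'} {t' : E.El T'} (hx : HEq x x') (hy : HEq y y')
    (hz : HEq z z') (ht : HEq t t') {r : W.Wit f x y} {s : W.Wit g z t}
    {r' : W.Wit f' x' y'} {s' : W.Wit g' z' t'} (hr : HEq r r') (hs : HEq s s') :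
    HEq (W.tensor r s) (W.tensor r' s') := by
  subst hX hY hZ hT; cases hf; cases hg; cases hx; cases hy; cases hz; cases ht
  cases hr; cases hs; rfl

theorem heq_of_subsingleton {X Y X' Y' : C} (hX : X = X') (hY : Y = Y') {f : X ⟶ Y}
    {f' : X' ⟶ Y'} (hf : HEq f f') {x : E.El X} {y : E.El Y} {x' : E.El X'} {y' : E.El Y'}
    (hx : HEq x x') (hy : HEq y y') (h : Subsingleton (W.Wit f x y)) (s : W.Wit f x y)
    (s' : W.Wit f' x' y') : HEq s s' := by
  subst hX hY; cases hf; cases hx; cases hy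
  exact heq_of_eq (Subsingleton.elim _ _)

end Witnesses

/-- The Grothendieck construction. Its objects are the pairs of an object and an element. -/
structure Total (W : Witnesses.{v} E) where
  base : C
  elt : E.El base

namespace Total

variable {W : Witnesses.{v} E}

/-- A morphism is a pair `(f, s)` of a morphism `f` and a witness `s` of `f`. -/
instance : Category.{max v₁ v} (Total W) where
  Hom A B := Σ f : A.base ⟶ B.base, W.Wit f A.elt B.elt
  id A := ⟨𝟙 A.base, W.id A.elt⟩
  comp f g := ⟨f.1 ≫ g.1, W.comp f.2 g.2⟩
  id_comp f := Sigma.ext (Category.id_comp _) (W.id_comp _)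
  comp_id f := Sigma.ext (Category.comp_id _) (W.comp_id _)
  assoc f g h := Sigma.ext (Category.assoc _ _ _) (W.assoc _ _ _)

theorem obj_ext {A B : Total W} (h : A.base = B.base) (h' : HEq A.elt B.elt) : A = B := by
  cases A; cases B; cases h; cases h'; rfl

instance : Monoid (Total W) where
  mul A B := ⟨A.base * B.base, E.pair A.elt B.elt⟩
  one := ⟨1, E.unit⟩
  mul_assoc _ _ _ := obj_ext (mul_assoc _ _ _) (E.pair_assoc _ _ _)
  one_mul _ := obj_ext (one_mul _) (E.unit_pair _)
  mul_one _ := obj_ext (mul_one _) (E.pair_unit _)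

theorem hom_heq {A B A' B' : Total W} (hA : A = A') (hB : B = B') {f : A ⟶ B} {f' : A' ⟶ B'}
    (h : HEq f.1 f'.1) (h' : HEq f.2 f'.2) : HEq f f' := by
  subst hA hB
  exact heq_of_eq (Sigma.ext (eq_of_heq h) h')

theorem eqToHom_fst {A B : Total W} (h : A = B) :
    (eqToHom h : A ⟶ B).1 = eqToHom (congrArg Total.base h) := by
  subst h; rfl

instance : StrictSymmMon (Total W) where
  tensor f g := ⟨StrictSymmMon.tensor f.1 g.1, W.tensor f.2 g.2⟩
  tensor_id A B := (Sigma.ext (StrictSymmMon.tensor_id _ _).symm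
    (W.heq_of_subsingleton rfl rfl (heq_of_eq (StrictSymmMon.tensor_id _ _).symm) HEq.rfl HEq.rfl
      (W.id_subsingleton _ _) _ _)).symm
  tensor_comp f g f' g' := Sigma.ext (StrictSymmMon.tensor_comp _ _ _ _) (W.tensor_comp _ _ _ _)
  tensor_assoc f g h := hom_heq (mul_assoc _ _ _) (mul_assoc _ _ _)
    (StrictSymmMon.tensor_assoc _ _ _) (W.tensor_assoc _ _ _)
  unit_tensor f := hom_heq (one_mul _) (one_mul _) (StrictSymmMon.unit_tensor _)
    (W.unit_tensor _)
  tensor_unit f := hom_heq (mul_one _) (mul_one _) (StrictSymmMon.tensor_unit _)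
    (W.tensor_unit _)
  braid A B := ⟨StrictSymmMon.braid A.base B.base, W.braid A.elt B.elt⟩
  braid_natural f g := Sigma.ext (StrictSymmMon.braid_natural _ _) (W.braid_natural _ _)
  braid_braid A B := (Sigma.ext (StrictSymmMon.braid_braid _ _).symm
    (W.heq_of_subsingleton rfl rfl (heq_of_eq (StrictSymmMon.braid_braid _ _).symm) HEq.rfl HEq.rfl
      (W.id_subsingleton _ _) _ _)).symm
  hexagon A B D := by
    have key : HEq (StrictSymmMon.braid A.base (B.base * D.base))
        (StrictSymmMon.tensor (StrictSymmMon.braid A.base B.base) (𝟙 D.base) ≫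
          (eqToHom (mul_assoc B A D) : B * A * D ⟶ B * (A * D)).1 ≫
            StrictSymmMon.tensor (𝟙 B.base) (StrictSymmMon.braid A.base D.base)) := by
      rw [eqToHom_fst]
      exact StrictSymmMon.hexagon _ _ _
    exact hom_heq (mul_assoc A B D).symm (mul_assoc B D A) key
      (W.heq_of_subsingleton (mul_assoc _ _ _).symm (mul_assoc _ _ _) key (E.pair_assoc _ _ _).symm
        (E.pair_assoc _ _ _) (W.braid_subsingleton _ _) _ _)

/-- The projection to the base category. -/
def proj (W : Witnesses.{v} E) : StrictFunctor (Total W) C where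
  obj A := A.base
  map f := f.1
  obj_one := rfl
  obj_mul _ _ := rfl
  map_tensor _ _ := HEq.rfl
  map_braid _ _ := HEq.rfl

/-- The functor between Grothendieck constructions given by a functor between the bases and
compatible maps of elements and of witnesses. -/
def lift {C' : Type u₂} [Category.{v₂} C'] [StrictSymmMon C'] {E' : Elements.{w} C'}
    (W' : Witnesses.{v} E') (W : Witnesses.{v} E) (G : StrictFunctor C' C)
    (onEl : ∀ {X : C'}, E'.El X → E.El (G.obj X))
    (onWit : ∀ {X Y : C'} {f : X ⟶ Y} {x : E'.El X} {y : E'.El Y},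
      W'.Wit f x y → W.Wit (G.map f) (onEl x) (onEl y))
    (h_unit : HEq (onEl E'.unit) E.unit)
    (h_pair : ∀ {X Y : C'} (x : E'.El X) (y : E'.El Y),
      HEq (onEl (E'.pair x y)) (E.pair (onEl x) (onEl y)))
    (h_comp : ∀ {X Y Z : C'} {f : X ⟶ Y} {g : Y ⟶ Z} {x : E'.El X} {y : E'.El Y} {z : E'.El Z}
      (s : W'.Wit f x y) (t : W'.Wit g y z),
      HEq (onWit (W'.comp s t)) (W.comp (onWit s) (onWit t)))
    (h_tensor : ∀ {X Y X' Y' : C'} {f : X ⟶ Y} {g : X' ⟶ Y'} {x : E'.El X} {y : E'.El Y}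
      {x' : E'.El X'} {y' : E'.El Y'} (s : W'.Wit f x y) (t : W'.Wit g x' y'),
      HEq (onWit (W'.tensor s t)) (W.tensor (onWit s) (onWit t))) :
    StrictFunctor (Total W') (Total W) where
  obj A := ⟨G.obj A.base, onEl A.elt⟩
  map f := ⟨G.map f.1, onWit f.2⟩
  map_id A := (Sigma.ext (G.map_id _).symm (W.heq_of_subsingleton rfl rfl
    (heq_of_eq (G.map_id _).symm) HEq.rfl HEq.rfl (W.id_subsingleton _ _) _ _)).symm
  map_comp f g := Sigma.ext (G.map_comp _ _) (h_comp _ _)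
  obj_one := obj_ext G.obj_one h_unit
  obj_mul A B := obj_ext (G.obj_mul _ _) (h_pair _ _)
  map_tensor f g := hom_heq (obj_ext (G.obj_mul _ _) (h_pair _ _))
    (obj_ext (G.obj_mul _ _) (h_pair _ _)) (G.map_tensor _ _) (h_tensor _ _)
  map_braid A B := (hom_heq (obj_ext (G.obj_mul _ _) (h_pair _ _)).symm
    (obj_ext (G.obj_mul _ _) (h_pair _ _)).symm (G.map_braid _ _).symm
    (W.heq_of_subsingleton (G.obj_mul _ _).symm (G.obj_mul _ _).symm (G.map_braid _ _).symm
      (h_pair _ _).symm (h_pair _ _).symm (W.braid_subsingleton _ _) _ _)).symm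

end Total

end Total

/-! ### Internalization of a semantics in partial functions -/

namespace SetStar

theorem pair_heq {L₁ L₂ L₁' L₂' : SetStar.{u}} (h₁ : L₁ = L₁') (h₂ : L₂ = L₂') {x : El L₁}
    {y : El L₂} {x' : El L₁'} {y' : El L₂'} (hx : HEq x x') (hy : HEq y y') :
    HEq (pair x y) (pair x' y') := by
  subst h₁ h₂; cases hx; cases hy; rfl

variable {C : Type u₁} [Category.{v₁} C] [StrictSymmMon C]
  {C' : Type u₂} [Category.{v₂} C'] [StrictSymmMon C']

/-- The elements of an object `X` are the elements of its image under a functor. -/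
def elements (F : StrictFunctor C SetStar.{u}) : Elements.{u} C where
  El X := El (F.obj X)
  unit := cast (congrArg El F.obj_one.symm) unit
  pair {X Y} x y := cast (congrArg El (F.obj_mul X Y).symm) (pair x y)
  pair_assoc {X Y Z} x y z := by
    refine (cast_heq _ _).trans (HEq.trans ?_ (cast_heq _ _).symm)
    refine (pair_heq (F.obj_mul X Y) rfl (cast_heq _ _) HEq.rfl).trans ?_
    refine (pair_assoc x y z).trans ?_
    exact pair_heq rfl (F.obj_mul Y Z).symm HEq.rfl (cast_heq _ _).symm
  unit_pair x := (cast_heq _ _).trans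
    ((pair_heq F.obj_one rfl (cast_heq _ _) HEq.rfl).trans (unit_pair x))
  pair_unit x := (cast_heq _ _).trans
    ((pair_heq rfl F.obj_one HEq.rfl (cast_heq _ _)).trans (pair_unit x))

theorem elements_unit_heq (F : StrictFunctor C SetStar.{u}) :
    HEq (elements F).unit unit := cast_heq _ _

theorem elements_pair_heq (F : StrictFunctor C SetStar.{u}) {X Y : C} (x : El (F.obj X))
    (y : El (F.obj Y)) : HEq ((elements F).pair x y) (pair x y) := cast_heq _ _

theorem elements_comp_unit_heq (G : StrictFunctor C' C) (F : StrictFunctor C SetStar.{u}) :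
    HEq (elements (G.comp F)).unit (elements F).unit :=
  (elements_unit_heq (G.comp F)).trans (elements_unit_heq F).symm

theorem elements_comp_pair_heq (G : StrictFunctor C' C) (F : StrictFunctor C SetStar.{u}) {X Y : C'}
    (x : (elements (G.comp F)).El X) (y : (elements (G.comp F)).El Y) :
    HEq ((elements (G.comp F)).pair x y)
      ((elements F).pair (X := G.obj X) (Y := G.obj Y) x y) :=
  (elements_pair_heq (G.comp F) x y).trans
    (elements_pair_heq F (X := G.obj X) (Y := G.obj Y) x y).symm

theorem maps_map_tensor (F : StrictFunctor C SetStar.{u}) {X Y X' Y' : C} (f : X ⟶ Y)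
    (g : X' ⟶ Y') (x : El (F.obj X)) (y : El (F.obj Y)) (x' : El (F.obj X')) (y' : El (F.obj Y')) :
    Maps (F.map (StrictSymmMon.tensor f g)) ((elements F).pair x x') ((elements F).pair y y') ↔
      Maps (F.map f) x y ∧ Maps (F.map g) x' y' :=
  (maps_congr (F.obj_mul _ _) (F.obj_mul _ _) (F.map_tensor f g) (elements_pair_heq F _ _)
    (elements_pair_heq F _ _)).trans maps_tensor

theorem maps_map_braid (F : StrictFunctor C SetStar.{u}) {X Y : C} (x : El (F.obj X))
    (y : El (F.obj Y)) :
    Maps (F.map (StrictSymmMon.braid X Y)) ((elements F).pair x y) ((elements F).pair y x) :=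
  (maps_congr (F.obj_mul _ _) (F.obj_mul _ _) (F.map_braid X Y) (elements_pair_heq F _ _)
    (elements_pair_heq F _ _)).2 (maps_braid.2 rfl)

theorem maps_map_id (F : StrictFunctor C SetStar.{u}) {X : C} (x y : El (F.obj X)) :
    Maps (F.map (𝟙 X)) x y ↔ y = x := by
  rw [F.map_id]; exact maps_id

theorem maps_map_comp (F : StrictFunctor C SetStar.{u}) {X Y Z : C} (f : X ⟶ Y) (g : Y ⟶ Z)
    (x : El (F.obj X)) (z : El (F.obj Z)) :
    Maps (F.map (f ≫ g)) x z ↔ ∃ y, Maps (F.map f) x y ∧ Maps (F.map g) y z := by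
  rw [F.map_comp]; exact maps_comp

/-- There is exactly one witness of `f` from `x` to `y` if the partial function assigned to `f` is
defined at `x` with value `y`, and none otherwise. -/
def witnesses (F : StrictFunctor C SetStar.{u}) : Witnesses.{0} (elements F) :=
  let W : ∀ {X Y : C}, (X ⟶ Y) → El (F.obj X) → El (F.obj Y) → Type :=
    fun f x y => PLift (Maps (F.map f) x y)
  have hW : ∀ {X Y X' Y' : C} (_ : X = X') (_ : Y = Y') {f : X ⟶ Y} {f' : X' ⟶ Y'} (_ : HEq f f')
      {x : El (F.obj X)} {y : El (F.obj Y)} {x' : El (F.obj X')} {y' : El (F.obj Y')}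
      (_ : HEq x x') (_ : HEq y y') (s : W f x y) (s' : W f' x' y'), HEq s s' := by
    intro X Y X' Y' hX hY f f' hf x y x' y' hx hy s s'
    subst hX hY; cases hf; cases hx; cases hy
    exact heq_of_eq (Subsingleton.elim (α := PLift _) _ _)
  { Wit := W
    id := fun x => ⟨(maps_map_id F x x).2 rfl⟩
    comp := fun s t => ⟨(maps_map_comp F _ _ _ _).2 ⟨_, s.down, t.down⟩⟩
    tensor := fun s t => ⟨(maps_map_tensor F _ _ _ _ _ _).2 ⟨s.down, t.down⟩⟩
    braid := fun x y => ⟨maps_map_braid F x y⟩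
    id_subsingleton := fun _ _ => inferInstanceAs (Subsingleton (PLift _))
    braid_subsingleton := fun _ _ => inferInstanceAs (Subsingleton (PLift _))
    id_comp := fun _ => hW rfl rfl (heq_of_eq (Category.id_comp _)) HEq.rfl HEq.rfl _ _
    comp_id := fun _ => hW rfl rfl (heq_of_eq (Category.comp_id _)) HEq.rfl HEq.rfl _ _
    assoc := fun _ _ _ => hW rfl rfl (heq_of_eq (Category.assoc _ _ _)) HEq.rfl HEq.rfl _ _
    tensor_comp := fun _ _ _ _ => hW rfl rfl (heq_of_eq (StrictSymmMon.tensor_comp _ _ _ _))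
      HEq.rfl HEq.rfl _ _
    tensor_assoc := fun _ _ _ => hW (mul_assoc _ _ _) (mul_assoc _ _ _)
      (StrictSymmMon.tensor_assoc _ _ _) ((elements F).pair_assoc _ _ _)
      ((elements F).pair_assoc _ _ _) _ _
    unit_tensor := fun _ => hW (one_mul _) (one_mul _) (StrictSymmMon.unit_tensor _)
      ((elements F).unit_pair _) ((elements F).unit_pair _) _ _
    tensor_unit := fun _ => hW (mul_one _) (mul_one _) (StrictSymmMon.tensor_unit _)
      ((elements F).pair_unit _) ((elements F).pair_unit _) _ _
    braid_natural := fun _ _ => hW rfl rfl (heq_of_eq (StrictSymmMon.braid_natural _ _))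
      HEq.rfl HEq.rfl _ _ }

theorem wit_subsingleton (F : StrictFunctor C SetStar.{u}) {X Y : C} (f : X ⟶ Y)
    (x : (elements F).El X) (y : (elements F).El Y) : Subsingleton ((witnesses F).Wit f x y) :=
  inferInstanceAs (Subsingleton (PLift _))

/-- The internalization of a semantics in partial functions: objects are pairs `(X, x)` with `x`
an element of the image of `X`, morphisms from `(X, x)` to `(Y, y)` are the morphisms `f : X ⟶ Y`
whose image is defined at `x` with value `y`. -/
abbrev Internalization (F : StrictFunctor C SetStar.{u}) : Type (max u₁ u) := Total (witnesses F)

/-- The lift of `G` to internalizations, for a functor into `SetStar` and its composite with `G`. -/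
def liftComp (G : StrictFunctor C' C) (F : StrictFunctor C SetStar.{u}) :
    StrictFunctor (Internalization (G.comp F)) (Internalization F) :=
  Total.lift (witnesses (G.comp F)) (witnesses F) G (fun x => x) (fun s => ⟨s.down⟩)
    (elements_comp_unit_heq G F) (fun x y => elements_comp_pair_heq G F x y)
    (fun _ _ => (witnesses F).heq_of_subsingleton rfl rfl (heq_of_eq (G.map_comp _ _)) HEq.rfl
      HEq.rfl (wit_subsingleton F _ _ _) _ _)
    (fun _ _ => (witnesses F).heq_of_subsingleton (G.obj_mul _ _) (G.obj_mul _ _)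
      (G.map_tensor _ _) (elements_comp_pair_heq G F _ _) (elements_comp_pair_heq G F _ _)
      (wit_subsingleton F _ _ _) _ _)

/-- The lift of a functor `G` with `F' = G ≫ F` to internalizations, sending `(X, x)` to
`(G X, x)` and `f` to `G f`. -/
def lift {F' : StrictFunctor C' SetStar.{u}} {F : StrictFunctor C SetStar.{u}}
    (G : StrictFunctor C' C) (h : F' = G.comp F) :
    StrictFunctor (Internalization F') (Internalization F) :=
  match F', h with
  | _, rfl => liftComp G F

end SetStar

/-! ### Internalization of a semantics in spans -/

namespace SpanCat

theorem pair_heq {L₁ L₂ L₁' L₂' : SpanCat.{u}} (h₁ : L₁ = L₁') (h₂ : L₂ = L₂') {x : El L₁}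
    {y : El L₂} {x' : El L₁'} {y' : El L₂'} (hx : HEq x x') (hy : HEq y y') :
    HEq (pair x y) (pair x' y') := by
  subst h₁ h₂; cases hx; cases hy; rfl

variable {C : Type u₁} [Category.{v₁} C] [StrictSymmMon C]
  {C' : Type u₂} [Category.{v₂} C'] [StrictSymmMon C']

/-- The elements of an object `X` are the elements of its image under a functor. -/
def elements (F : StrictFunctor C SpanCat.{u}) : Elements.{u} C where
  El X := El (F.obj X)
  unit := cast (congrArg El F.obj_one.symm) unit
  pair {X Y} x y := cast (congrArg El (F.obj_mul X Y).symm) (pair x y)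
  pair_assoc {X Y Z} x y z := by
    refine (cast_heq _ _).trans (HEq.trans ?_ (cast_heq _ _).symm)
    refine (pair_heq (F.obj_mul X Y) rfl (cast_heq _ _) HEq.rfl).trans ?_
    refine (pair_assoc x y z).trans ?_
    exact pair_heq rfl (F.obj_mul Y Z).symm HEq.rfl (cast_heq _ _).symm
  unit_pair x := (cast_heq _ _).trans
    ((pair_heq F.obj_one rfl (cast_heq _ _) HEq.rfl).trans (unit_pair x))
  pair_unit x := (cast_heq _ _).trans
    ((pair_heq rfl F.obj_one HEq.rfl (cast_heq _ _)).trans (pair_unit x))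

theorem elements_unit_heq (F : StrictFunctor C SpanCat.{u}) :
    HEq (elements F).unit unit := cast_heq _ _

theorem elements_pair_heq (F : StrictFunctor C SpanCat.{u}) {X Y : C} (x : El (F.obj X))
    (y : El (F.obj Y)) : HEq ((elements F).pair x y) (pair x y) := cast_heq _ _

theorem elements_comp_unit_heq (G : StrictFunctor C' C) (F : StrictFunctor C SpanCat.{u}) :
    HEq (elements (G.comp F)).unit (elements F).unit :=
  (elements_unit_heq (G.comp F)).trans (elements_unit_heq F).symm

theorem elements_comp_pair_heq (G : StrictFunctor C' C) (F : StrictFunctor C SpanCat.{u}) {X Y : C'}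
    (x : (elements (G.comp F)).El X) (y : (elements (G.comp F)).El Y) :
    HEq ((elements (G.comp F)).pair x y)
      ((elements F).pair (X := G.obj X) (Y := G.obj Y) x y) :=
  (elements_pair_heq (G.comp F) x y).trans
    (elements_pair_heq F (X := G.obj X) (Y := G.obj Y) x y).symm


/-- A strict symmetric monoidal functor `F` to spans assigns to a morphism only an isomorphism
class of spans. To speak about elements of the apex of `F f` one has to choose a span in every
class, together with isomorphisms that identify the chosen span of `f ≫ g` with the pullback of
those of `f` and `g`, and the chosen span of a tensor product with the product. These choices have
to be coherent, so that composition of pairs `(f, s)`, `s` in the apex of `F f`, is associative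
and so on. A realization of `F` is such a coherent choice. The chosen span of `f : X ⟶ Y` is given
by the sets `Wit f x y` of the elements of its apex that lie over `(x, y)`. -/
structure Realization (F : StrictFunctor C SpanCat.{u}) extends Witnesses.{u} (elements F) where
  realizes : ∀ {X Y : C} (f : X ⟶ Y), F.map f = mk (Spn.ofFamily (Wit f))
  comp_bijective : ∀ {X Y Z : C} (f : X ⟶ Y) (g : Y ⟶ Z) (x : (elements F).El X)
    (z : (elements F).El Z), Function.Bijective
      (fun p : (Σ y : (elements F).El Y, Wit f x y × Wit g y z) => comp p.2.1 p.2.2)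
  tensor_bijective : ∀ {X Y X' Y' : C} (f : X ⟶ Y) (g : X' ⟶ Y') (x : (elements F).El X)
    (y : (elements F).El Y) (x' : (elements F).El X') (y' : (elements F).El Y'),
    Function.Bijective (fun p : Wit f x y × Wit g x' y' => tensor p.1 p.2)

/-- The internalization of a semantics in spans: objects are pairs `(X, x)` with `x` an element of
the image of `X`, morphisms from `(X, x)` to `(Y, y)` are pairs `(f, s)` of a morphism `f : X ⟶ Y`
and an element `s` of the apex of the span of `f` that lies over `(x, y)`. -/
abbrev Internalization {F : StrictFunctor C SpanCat.{u}} (R : Realization F) :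
    Type (max u₁ u) := Total R.toWitnesses

namespace Realization

variable (G : StrictFunctor C' C) {F : StrictFunctor C SpanCat.{u}} (R : Realization F)

theorem wit_comp_eq {X Y Z : C'} (f : X ⟶ Y) (g : Y ⟶ Z) (x : (elements F).El (G.obj X))
    (z : (elements F).El (G.obj Z)) :
    R.Wit (G.map f ≫ G.map g) x z = R.Wit (G.map (f ≫ g)) x z :=
  R.wit_congr rfl rfl (heq_of_eq (G.map_comp f g).symm) HEq.rfl HEq.rfl

theorem wit_tensor_eq {X Y X' Y' : C'} (f : X ⟶ Y) (g : X' ⟶ Y')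
    (x : (elements (G.comp F)).El X) (y : (elements (G.comp F)).El Y)
    (x' : (elements (G.comp F)).El X') (y' : (elements (G.comp F)).El Y') :
    R.Wit (StrictSymmMon.tensor (G.map f) (G.map g))
        ((elements F).pair (X := G.obj X) (Y := G.obj X') x x')
        ((elements F).pair (X := G.obj Y) (Y := G.obj Y') y y') =
      R.Wit (X := G.obj (X * X')) (Y := G.obj (Y * Y')) (G.map (StrictSymmMon.tensor f g))
        ((elements (G.comp F)).pair x x') ((elements (G.comp F)).pair y y') :=
  R.wit_congr (G.obj_mul _ _).symm (G.obj_mul _ _).symm (G.map_tensor f g).symm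
    (elements_comp_pair_heq G F x x').symm (elements_comp_pair_heq G F y y').symm

theorem wit_id_eq (X : C') (x y : (elements F).El (G.obj X)) :
    R.Wit (𝟙 (G.obj X)) x y = R.Wit (G.map (𝟙 X)) x y :=
  R.wit_congr rfl rfl (heq_of_eq (G.map_id X).symm) HEq.rfl HEq.rfl

theorem wit_braid_eq {X Y : C'} (x : (elements (G.comp F)).El X)
    (y : (elements (G.comp F)).El Y) :
    R.Wit (StrictSymmMon.braid (G.obj X) (G.obj Y))
        ((elements F).pair (X := G.obj X) (Y := G.obj Y) x y)
        ((elements F).pair (X := G.obj Y) (Y := G.obj X) y x) =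
      R.Wit (X := G.obj (X * Y)) (Y := G.obj (Y * X)) (G.map (StrictSymmMon.braid X Y))
        ((elements (G.comp F)).pair x y) ((elements (G.comp F)).pair y x) :=
  R.wit_congr (G.obj_mul _ _).symm (G.obj_mul _ _).symm (G.map_braid X Y).symm
    (elements_comp_pair_heq G F x y).symm (elements_comp_pair_heq G F y x).symm

/-- The witnesses of `f` for the composite of `G` and `F` are those of `G f` for `F`. -/
def restrictWitnesses : Witnesses.{u} (elements (G.comp F)) :=
  have P := fun {X Y : C'} (x : (elements (G.comp F)).El X) (y : (elements (G.comp F)).El Y) =>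
    elements_comp_pair_heq G F x y
  have M := G.obj_mul
  { Wit := fun {X Y} f x y => R.Wit (X := G.obj X) (Y := G.obj Y) (G.map f) x y
    id := fun {X} x => cast (R.wit_id_eq G X x x) (R.id (X := G.obj X) x)
    comp := fun {X Y Z f g x y z} s t => cast (R.wit_comp_eq G f g x z) (R.comp s t)
    tensor := fun {X Y X' Y' f g x y x' y'} s t =>
      cast (R.wit_tensor_eq G f g x y x' y') (R.tensor s t)
    braid := fun {X Y} x y => cast (R.wit_braid_eq G x y)
      (R.braid (X := G.obj X) (Y := G.obj Y) x y)
    id_subsingleton := fun {X} x y => by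
      rw [← R.wit_id_eq G X x y]
      exact R.id_subsingleton (X := G.obj X) x y
    braid_subsingleton := fun {X Y} x y => by
      have e : R.Wit (StrictSymmMon.braid (G.obj X) (G.obj Y))
            (cast (congrArg (elements F).El (M X Y)) x)
            (cast (congrArg (elements F).El (M Y X)) y) =
          R.Wit (X := G.obj (X * Y)) (Y := G.obj (Y * X)) (G.map (StrictSymmMon.braid X Y)) x y :=
        R.wit_congr (M _ _).symm (M _ _).symm (G.map_braid X Y).symm (cast_heq _ _) (cast_heq _ _)
      rw [← e]
      exact R.braid_subsingleton _ _
    id_comp := fun {X Y f x y} s => by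
      refine (cast_heq _ _).trans (HEq.trans ?_ (R.id_comp s))
      exact R.comp_heq rfl rfl rfl (heq_of_eq (G.map_id _)) HEq.rfl HEq.rfl HEq.rfl HEq.rfl
        (cast_heq _ _) HEq.rfl
    comp_id := fun {X Y f x y} s => by
      refine (cast_heq _ _).trans (HEq.trans ?_ (R.comp_id s))
      exact R.comp_heq rfl rfl rfl HEq.rfl (heq_of_eq (G.map_id _)) HEq.rfl HEq.rfl HEq.rfl
        HEq.rfl (cast_heq _ _)
    assoc := fun {X Y Z T f g h x y z t} r s q => by
      refine (cast_heq _ _).trans (HEq.trans ?_ (cast_heq _ _).symm)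
      refine (R.comp_heq rfl rfl rfl (heq_of_eq (G.map_comp f g)) HEq.rfl HEq.rfl HEq.rfl HEq.rfl
        (cast_heq _ _) HEq.rfl).trans ((R.assoc r s q).trans ?_)
      exact R.comp_heq rfl rfl rfl HEq.rfl (heq_of_eq (G.map_comp g h).symm) HEq.rfl HEq.rfl
        HEq.rfl HEq.rfl (cast_heq _ _).symm
    tensor_comp := fun {X Y Z X' Y' Z' f g f' g' x y z x' y' z'} s t s' t' => by
      refine (cast_heq _ _).trans (HEq.trans ?_ (cast_heq _ _).symm)
      refine (R.tensor_heq rfl rfl rfl rfl (heq_of_eq (G.map_comp f g))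
        (heq_of_eq (G.map_comp f' g')) HEq.rfl HEq.rfl HEq.rfl HEq.rfl (cast_heq _ _)
        (cast_heq _ _)).trans ((R.tensor_comp s t s' t').trans ?_)
      exact R.comp_heq (M _ _).symm (M _ _).symm (M _ _).symm (G.map_tensor f f').symm
        (G.map_tensor g g').symm (P _ _).symm (P _ _).symm (P _ _).symm (cast_heq _ _).symm
        (cast_heq _ _).symm
    tensor_assoc := fun {X Y Z X' Y' Z' f g h x y z x' y' z'} r s t => by
      refine (cast_heq _ _).trans (HEq.trans ?_ (cast_heq _ _).symm)
      refine (R.tensor_heq (M _ _) (M _ _) rfl rfl (G.map_tensor f g) HEq.rfl (P _ _) (P _ _)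
        HEq.rfl HEq.rfl (cast_heq _ _) HEq.rfl).trans ((R.tensor_assoc r s t).trans ?_)
      exact R.tensor_heq rfl rfl (M _ _).symm (M _ _).symm HEq.rfl (G.map_tensor g h).symm
        HEq.rfl HEq.rfl (P _ _).symm (P _ _).symm HEq.rfl (cast_heq _ _).symm
    unit_tensor := fun {X Y f x y} s => by
      refine (cast_heq _ _).trans (HEq.trans ?_ (R.unit_tensor s))
      have U := elements_comp_unit_heq G F
      have e : HEq (G.map (𝟙 (1 : C'))) (𝟙 (1 : C)) :=
        (heq_of_eq (G.map_id _)).trans (id_heq G.obj_one)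
      exact R.tensor_heq G.obj_one G.obj_one rfl rfl e HEq.rfl U U HEq.rfl HEq.rfl
        (R.heq_of_subsingleton G.obj_one.symm G.obj_one.symm e.symm U.symm U.symm
          (R.id_subsingleton _ _) _ _).symm HEq.rfl
    tensor_unit := fun {X Y f x y} s => by
      refine (cast_heq _ _).trans (HEq.trans ?_ (R.tensor_unit s))
      have U := elements_comp_unit_heq G F
      have e : HEq (G.map (𝟙 (1 : C'))) (𝟙 (1 : C)) :=
        (heq_of_eq (G.map_id _)).trans (id_heq G.obj_one)
      exact R.tensor_heq rfl rfl G.obj_one G.obj_one HEq.rfl e HEq.rfl HEq.rfl U U HEq.rfl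
        (R.heq_of_subsingleton G.obj_one.symm G.obj_one.symm e.symm U.symm U.symm
          (R.id_subsingleton _ _) _ _).symm
    braid_natural := fun {X Y X' Y' f g x y x' y'} s t => by
      refine (cast_heq _ _).trans (HEq.trans ?_ (cast_heq _ _).symm)
      refine (R.comp_heq (M _ _) (M _ _) (M _ _) (G.map_tensor f g) (G.map_braid _ _) (P _ _)
        (P _ _) (P _ _) (cast_heq _ _) (cast_heq _ _)).trans ((R.braid_natural s t).trans ?_)
      exact R.comp_heq (M _ _).symm (M _ _).symm (M _ _).symm (G.map_braid _ _).symm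
        (G.map_tensor g f).symm (P _ _).symm (P _ _).symm (P _ _).symm (cast_heq _ _).symm
        (cast_heq _ _).symm }

theorem bijective_cast_comp {A B B' : Type u} (h : B = B') {φ : A → B}
    (hφ : Function.Bijective φ) : Function.Bijective (fun a => cast h (φ a)) := by
  subst h; exact hφ

/-- A realization of `F` restricts to a realization of the composite of `G` and `F`. -/
def restrictComp : Realization (G.comp F) where
  toWitnesses := R.restrictWitnesses G
  realizes f := R.realizes (G.map f)
  comp_bijective f g x z := bijective_cast_comp (R.wit_comp_eq G f g x z)
    (R.comp_bijective (G.map f) (G.map g) x z)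
  tensor_bijective f g x y x' y' := bijective_cast_comp (R.wit_tensor_eq G f g x y x' y')
    (R.tensor_bijective (G.map f) (G.map g) x y x' y')

/-- The restriction of a realization of `F` along `G`, for a functor `F' = G ≫ F`. -/
def restrict {F' : StrictFunctor C' SpanCat.{u}} (h : F' = G.comp F) : Realization F' :=
  match F', h with
  | _, rfl => R.restrictComp G

end Realization

/-- The lift of `G` to internalizations, for a functor into `SpanCat` and its composite with
`G`. -/
def liftComp (G : StrictFunctor C' C) {F : StrictFunctor C SpanCat.{u}} (R : Realization F) :
    StrictFunctor (Internalization (R.restrictComp G)) (Internalization R) :=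
  Total.lift (R.restrictComp G).toWitnesses R.toWitnesses G (fun x => x) (fun s => s)
    (elements_comp_unit_heq G F) (fun x y => elements_comp_pair_heq G F x y)
    (fun _ _ => cast_heq _ _) (fun _ _ => cast_heq _ _)

/-- The lift of a functor `G` with `F' = G ≫ F` to internalizations, sending `(X, x)` to
`(G X, x)` and `(f, s)` to `(G f, s)`. -/
def lift {F' : StrictFunctor C' SpanCat.{u}} {F : StrictFunctor C SpanCat.{u}}
    (G : StrictFunctor C' C) (h : F' = G.comp F) (R : Realization F) :
    StrictFunctor (Internalization (R.restrict G h)) (Internalization R) :=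
  match F', h with
  | _, rfl => liftComp G R

end SpanCat

end GuardedNets

open GuardedNets

/-! The projection of an internalization to `𝔉(N)` lifts decompositions uniquely. An element of a
product is exactly one pair of elements. If `f = g ≫ h`, a witness of `f` from `x` to `z` is exactly
one choice of a middle element `y` together with witnesses of `g` and `h`; a witness of `f ⊗ g` is
exactly one pair of witnesses. For partial functions this holds because the middle value is
determined by `x`, for spans because apexes are pullbacks and products. Identities and braidings
have only the obvious witnesses.

Unique lifting along a functor `P : E ⥤ 𝔉(N)` makes `E` free
(`UniqueLifting.realize_arr_bijective`). The places of the net are the objects over single places,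
its transitions the morphisms over single transitions. For an expression `f` in the generators of
`N`, let `lifts f` be the set of morphisms, in the free category on the new net, that are built from
lifted generators in the shape of `f`. Interpretation in `E` maps `lifts f` bijectively to the
morphisms over `f`. Moreover `lifts f` depends only on the morphism denoted by `f`: for two sides of
an axiom one inclusion is easy to see, and it is an equality because both sets biject with the same
fibre. Hence the interpretation is bijective on morphisms.

Being an erasing turns out to be a condition on sets: `K` has all the places of `N`, and every
transition of `N` belongs to exactly one of `K` and `N_w` (`Complementary`). That pushouts have this
property is tested on functors to categories whose morphisms are labels in a commutative monoid
(`Complementary.of_isPushout`); the converse is the universal property of free categories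
(`Complementary.isPushout`).

Finally, the internalization of a subnet is the pullback of `∫ N^♯` along the inclusion of free
categories (`IsRestriction`). So a place or transition of the net of `∫ N^♯` lies in the net of the
internalized subnet as soon as the generator below it lies in the subnet, and complementarity passes
from the nets to the nets of the internalizations. -/

namespace GuardedNets

open StrictSymmMon

/-! ### Bundled morphisms

Morphisms are bundled with their endpoints, so that equations between morphisms with equal but
syntactically different endpoints become genuine equalities. -/

/-- A morphism together with its endpoints. -/
structure Arr (C : Type u₁) [Category.{v₁} C] where
  src : C
  tgt : C
  hom : src ⟶ tgt

namespace Arr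

section

variable {C : Type u₁} [Category.{v₁} C]

/-- The bundled form of a morphism. -/
abbrev of {a b : C} (f : a ⟶ b) : Arr C := ⟨a, b, f⟩

theorem of_eq_of {a b a' b' : C} {f : a ⟶ b} {g : a' ⟶ b'} (ha : a = a') (hb : b = b')
    (h : HEq f g) : of f = of g := by
  subst ha hb; cases h; rfl

theorem heq_of_of_eq {a b a' b' : C} {f : a ⟶ b} {g : a' ⟶ b'} (h : of f = of g) : HEq f g := by
  cases h; rfl

theorem eq_of_of_eq {a b : C} {f g : a ⟶ b} (h : of f = of g) : f = g :=
  eq_of_heq (heq_of_of_eq h)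

theorem of_id_injective : Function.Injective fun a : C => of (𝟙 a) :=
  fun _ _ h => congrArg src h

theorem comp_congr {a b c a' b' c' : C} {f : a ⟶ b} {g : b ⟶ c} {f' : a' ⟶ b'} {g' : b' ⟶ c'}
    (h : of f = of f') (h' : of g = of g') : of (f ≫ g) = of (f' ≫ g') := by
  cases h; cases h'; rfl

theorem of_eqToHom_comp {a b c : C} (h : a = b) (f : b ⟶ c) : of (eqToHom h ≫ f) = of f := by
  subst h; simp

theorem of_comp_eqToHom {a b c : C} (f : a ⟶ b) (h : b = c) : of (f ≫ eqToHom h) = of f := by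
  subst h; simp

theorem of_eqToHom {a b : C} (h : a = b) : of (eqToHom h) = of (𝟙 a) := by
  subst h; rfl

theorem exists_hom (φ : Arr C) {a b : C} (ha : φ.src = a) (hb : φ.tgt = b) :
    ∃ f : a ⟶ b, of f = φ := by
  subst ha hb; exact ⟨φ.hom, rfl⟩

end

section

variable {C : Type u₁} [Category.{v₁} C] [StrictSymmMon C]

/-- The tensor product of bundled morphisms is strictly associative and unital. -/
instance : Monoid (Arr C) where
  mul φ ψ := of (tensor φ.hom ψ.hom)
  one := of (𝟙 1)
  mul_assoc _ _ _ := of_eq_of (mul_assoc _ _ _) (mul_assoc _ _ _) (tensor_assoc _ _ _)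
  one_mul _ := of_eq_of (one_mul _) (one_mul _) (unit_tensor _)
  mul_one _ := of_eq_of (mul_one _) (mul_one _) (tensor_unit _)

theorem mul_def {a b c d : C} (f : a ⟶ b) (g : c ⟶ d) : of f * of g = of (tensor f g) := rfl

theorem of_tensor_id (a b : C) : of (𝟙 a) * of (𝟙 b) = of (𝟙 (a * b)) := by
  rw [mul_def, tensor_id]

end

end Arr

/-! ### Strict functors acting on bundled morphisms, and their inverses. -/

namespace StrictFunctor

variable {C : Type u₁} [Category.{v₁} C] [StrictSymmMon C]
  {D : Type u₂} [Category.{v₂} D] [StrictSymmMon D]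
  {E : Type u₃} [Category.{v₃} E] [StrictSymmMon E]

/-- The action of a strict symmetric monoidal functor on bundled morphisms. -/
def arr (F : StrictFunctor C D) (φ : Arr C) : Arr D := Arr.of (F.map φ.hom)

variable (F : StrictFunctor C D)

theorem arr_of {a b : C} (f : a ⟶ b) : F.arr (Arr.of f) = Arr.of (F.map f) := rfl

theorem arr_id (a : C) : F.arr (Arr.of (𝟙 a)) = Arr.of (𝟙 (F.obj a)) := by
  rw [arr_of, F.map_id]

theorem arr_comp {a b c : C} (f : a ⟶ b) (g : b ⟶ c) :
    F.arr (Arr.of (f ≫ g)) = Arr.of (F.map f ≫ F.map g) := by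
  rw [arr_of, F.map_comp]

theorem arr_mul (φ ψ : Arr C) : F.arr (φ * ψ) = F.arr φ * F.arr ψ :=
  Arr.of_eq_of (F.obj_mul _ _) (F.obj_mul _ _) (F.map_tensor _ _)

theorem arr_braid (a b : C) :
    F.arr (Arr.of (braid a b)) = Arr.of (braid (F.obj a) (F.obj b)) :=
  Arr.of_eq_of (F.obj_mul _ _) (F.obj_mul _ _) (F.map_braid _ _)

theorem arr_comp_arr (G : StrictFunctor D E) (φ : Arr C) : (F.comp G).arr φ = G.arr (F.arr φ) :=
  rfl

theorem ext_arr {F G : StrictFunctor C D} (h : ∀ φ, F.arr φ = G.arr φ) : F = G := by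
  have ho : ∀ a, F.obj a = G.obj a := fun a => congrArg Arr.src (h (Arr.of (𝟙 a)))
  refine ext' (CategoryTheory.Functor.hext ho fun a b f => Arr.heq_of_of_eq (h (Arr.of f)))

/-- An object can be recovered from its identity morphism, so injectivity on morphisms includes
injectivity on objects. -/
theorem obj_injective_of_arr {F : StrictFunctor C D} (h : Function.Injective F.arr) :
    Function.Injective F.obj := fun a b hab =>
  Arr.of_id_injective (h (by
    change F.arr (Arr.of (𝟙 a)) = F.arr (Arr.of (𝟙 b))
    rw [arr_id, arr_id, hab]))

/-- The inverse of a strict symmetric monoidal functor that is bijective on morphisms. -/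
noncomputable def inverse (h : Function.Bijective F.arr) : StrictFunctor D C :=
  let e := Equiv.ofBijective F.arr h
  have he : ∀ φ, F.arr (e.symm φ) = φ := e.apply_symm_apply
  have hi : Function.Injective F.arr := h.1
  have ho : Function.Injective F.obj := obj_injective_of_arr h.1
  -- The preimage of an identity is not yet known to be an identity, but its source is an object
  -- over `a`, and by injectivity the only one.
  let o : D → C := fun a => (e.symm (Arr.of (𝟙 a))).src
  have hoo : ∀ a, F.obj (o a) = a := fun a => congrArg Arr.src (he (Arr.of (𝟙 a)))
  have hs : ∀ φ : Arr D, (e.symm φ).src = o φ.src := fun φ => ho (by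
    rw [hoo]; exact congrArg Arr.src (he φ))
  have ht : ∀ φ : Arr D, (e.symm φ).tgt = o φ.tgt := fun φ => ho (by
    rw [hoo]; exact congrArg Arr.tgt (he φ))
  -- The endpoints of the preimage of `f` equal `o a` and `o b` only propositionally, whence the
  -- transport. Once `hm` is known, every axiom follows by applying `F` and cancelling it.
  let m : ∀ {a b : D} (f : a ⟶ b), o a ⟶ o b := fun f =>
    eqToHom (hs (Arr.of f)).symm ≫ (e.symm (Arr.of f)).hom ≫ eqToHom (ht (Arr.of f))
  have hm : ∀ {a b : D} (f : a ⟶ b), F.arr (Arr.of (m f)) = Arr.of f := fun f => by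
    rw [Arr.of_eqToHom_comp, Arr.of_comp_eqToHom]; exact he _
  { obj := o
    map := m
    map_id := fun a => Arr.eq_of_of_eq (hi (by rw [hm, arr_id, hoo]))
    map_comp := fun f g => Arr.eq_of_of_eq (hi (by
      rw [hm, arr_comp]
      exact (Arr.comp_congr (hm f) (hm g)).symm))
    obj_one := ho (by rw [hoo, F.obj_one])
    obj_mul := fun a b => ho (by rw [hoo, F.obj_mul, hoo, hoo])
    map_tensor := fun f g => Arr.heq_of_of_eq (hi (by
      rw [hm, ← Arr.mul_def (m f), arr_mul, hm, hm, Arr.mul_def]))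
    map_braid := fun a b => Arr.heq_of_of_eq (hi (by
      rw [hm, arr_braid, hoo, hoo])) }

theorem arr_arr_inverse (h : Function.Bijective F.arr) (φ : Arr D) :
    F.arr ((F.inverse h).arr φ) = φ := by
  have he := (Equiv.ofBijective F.arr h).apply_symm_apply φ
  refine Eq.trans (congrArg F.arr ?_) he
  exact (Arr.of_eqToHom_comp _ _).trans (Arr.of_comp_eqToHom _ _)

/-- A strict symmetric monoidal functor that is bijective on morphisms is an isomorphism. -/
noncomputable def isoOfBijective {A B : Type u} [Category.{u} A] [StrictSymmMon A]
    [Category.{u} B] [StrictSymmMon B] (F : StrictFunctor A B) (h : Function.Bijective F.arr) :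
    SSMCat.mk A ≅ SSMCat.mk B where
  hom := F.toHom
  inv := (F.inverse h).toHom
  hom_inv_id := ext_arr (F := F.comp (F.inverse h)) (G := StrictFunctor.id A) fun φ =>
    -- The left inverse law follows from the right one, applied at `F.arr φ`, by cancelling `F`.
    h.1 (F.arr_arr_inverse h (F.arr φ))
  inv_hom_id := ext_arr (F := (F.inverse h).comp F) (G := StrictFunctor.id B)
    (F.arr_arr_inverse h)

end StrictFunctor

/-! ### Functors out of free categories are determined by places and transitions. -/

namespace PetriNet

variable {N : PetriNet.{u}} {D : Type u₂} [Category.{v₂} D] [StrictSymmMon D]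

/-- A transition, as a bundled generating morphism. -/
def gen (t : N.Trans) : Arr N.Free := Arr.of (Term.gen t).hom

theorem exists_term (φ : Arr N.Free) : ∃ f : Term N φ.src φ.tgt, Arr.of f.hom = φ := by
  obtain ⟨a, b, ⟨f⟩⟩ := φ
  exact ⟨f, rfl⟩

theorem free_induction {p : N.Free → Prop} (one : p 1)
    (cons : ∀ x a, p a → p (ofPlace x * a)) (a : N.Free) : p a :=
  FreeMonoid.recOn (motive := p) a one cons

/-- A strict symmetric monoidal functor out of a free category is determined by its values on
places and transitions. -/
theorem functor_ext {F G : StrictFunctor N.Free D}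
    (hp : ∀ p : N.Place, F.obj (ofPlace p) = G.obj (ofPlace p))
    (ht : ∀ t : N.Trans, F.arr (gen t) = G.arr (gen t)) : F = G := by
  have ho : ∀ a : N.Free, F.obj a = G.obj a := by
    refine free_induction ?_ ?_
    · rw [F.obj_one, G.obj_one]
    · intro x a ih
      rw [F.obj_mul, G.obj_mul, hp, ih]
  refine StrictFunctor.ext_arr fun φ => ?_
  obtain ⟨f, hf⟩ := exists_term φ
  rw [← hf]
  generalize φ.src = a, φ.tgt = b at f
  clear hf
  induction f with
  | id a =>
    change F.arr (Arr.of (𝟙 a)) = G.arr (Arr.of (𝟙 a))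
    rw [F.arr_id, G.arr_id, ho]
  | comp f g ih ih' =>
    change F.arr (Arr.of (f.hom ≫ g.hom)) = G.arr (Arr.of (f.hom ≫ g.hom))
    rw [F.arr_comp, G.arr_comp]
    exact Arr.comp_congr ih ih'
  | tensor f g ih ih' =>
    change F.arr (Arr.of f.hom * Arr.of g.hom) = G.arr (Arr.of f.hom * Arr.of g.hom)
    rw [F.arr_mul, G.arr_mul, ih, ih']
  | braid a b =>
    change F.arr (Arr.of (StrictSymmMon.braid a b)) = G.arr (Arr.of (StrictSymmMon.braid a b))
    rw [F.arr_braid, G.arr_braid, ho, ho]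
  | gen t => exact ht t

section

variable (o : N.Place → D) (m : ∀ t : N.Trans, liftObj o (N.src t) ⟶ liftObj o (N.tgt t))

theorem lift_obj_ofPlace (p : N.Place) : (lift o m).obj (ofPlace p) = o p :=
  FreeMonoid.lift_eval_of o p

theorem lift_arr_gen (t : N.Trans) : (lift o m).arr (gen t) = Arr.of (m t) := rfl

end

theorem Inclusion.functor_obj_ofPlace {M : PetriNet.{u}} (i : Inclusion M N) (p : M.Place) :
    i.functor.obj (ofPlace p) = ofPlace (i.place p) :=
  lift_obj_ofPlace _ _ p

theorem Inclusion.functor_arr_gen {M : PetriNet.{u}} (i : Inclusion M N) (t : M.Trans) :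
    i.functor.arr (gen t) = gen (i.trans t) :=
  (lift_arr_gen _ _ t).trans ((Arr.of_eqToHom_comp _ _).trans (Arr.of_comp_eqToHom _ _))

theorem Inclusion.comp_obj_ofPlace {M : PetriNet.{u}} (i : Inclusion M N)
    (F : StrictFunctor N.Free D) (p : M.Place) :
    (i.functor.comp F).obj (ofPlace p) = F.obj (ofPlace (i.place p)) :=
  congrArg F.obj (i.functor_obj_ofPlace p)

theorem Inclusion.comp_arr_gen {M : PetriNet.{u}} (i : Inclusion M N)
    (F : StrictFunctor N.Free D) (t : M.Trans) :
    (i.functor.comp F).arr (gen t) = F.arr (gen (i.trans t)) :=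
  congrArg F.arr (i.functor_arr_gen t)

theorem ofPlace_injective : Function.Injective (ofPlace (N := N)) := FreeMonoid.of_injective

end PetriNet

end GuardedNets

namespace GuardedNets

open StrictSymmMon

/-! ### Unique lifting of decompositions -/

/-- Along `P`, every decomposition of the image of an object or a morphism as a unit, a product,
an identity, a composite, a tensor product or a braiding lifts uniquely. -/
structure UniqueLifting {E : Type u₁} [Category.{v₁} E] [StrictSymmMon E]
    {C : Type u₂} [Category.{v₂} C] [StrictSymmMon C] (P : StrictFunctor E C) : Prop where
  obj_one : ∀ A : E, P.obj A = 1 → A = 1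
  obj_mul : ∀ (A : E) (b c : C), P.obj A = b * c → ∃ B C, A = B * C ∧ P.obj B = b ∧ P.obj C = c
  obj_inj : ∀ A B A' B' : E, A * B = A' * B' → P.obj A = P.obj A' → P.obj B = P.obj B' →
    A = A' ∧ B = B'
  id : ∀ (φ : Arr E) (a : C), P.arr φ = Arr.of (𝟙 a) → ∃ A, P.obj A = a ∧ φ = Arr.of (𝟙 A)
  comp : ∀ (φ : Arr E) (a b c : C) (f : a ⟶ b) (g : b ⟶ c), P.arr φ = Arr.of (f ≫ g) →
    ∃ (A B C : E) (h : A ⟶ B) (k : B ⟶ C),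
      P.arr (Arr.of h) = Arr.of f ∧ P.arr (Arr.of k) = Arr.of g ∧ φ = Arr.of (h ≫ k)
  comp_inj : ∀ (A B C A' B' C' : E) (f : A ⟶ B) (g : B ⟶ C) (f' : A' ⟶ B') (g' : B' ⟶ C'),
    Arr.of (f ≫ g) = Arr.of (f' ≫ g') → P.arr (Arr.of f) = P.arr (Arr.of f') →
      P.arr (Arr.of g) = P.arr (Arr.of g') → Arr.of f = Arr.of f' ∧ Arr.of g = Arr.of g'
  tensor : ∀ (φ : Arr E) (f g : Arr C), P.arr φ = f * g →
    ∃ h k : Arr E, P.arr h = f ∧ P.arr k = g ∧ φ = h * k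
  tensor_inj : ∀ f g f' g' : Arr E, f * g = f' * g' → P.arr f = P.arr f' → P.arr g = P.arr g' →
    f = f' ∧ g = g'
  braid : ∀ (φ : Arr E) (a b : C), P.arr φ = Arr.of (braid a b) →
    ∃ A B, P.obj A = a ∧ P.obj B = b ∧ φ = Arr.of (StrictSymmMon.braid A B)

/-! ### Unique lifting over a free category implies freeness. -/

namespace UniqueLifting

open PetriNet

variable {N : PetriNet.{u}} {E : Type u} [Category.{u} E] [StrictSymmMon E]

/-- The objects over single places. -/
abbrev TotalPlace (P : StrictFunctor E N.Free) : Type u :=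
  {A : E // ∃ p : N.Place, P.obj A = ofPlace p}

/-- The object given by a word of objects over single places. -/
def word (P : StrictFunctor E N.Free) : FreeMonoid (TotalPlace P) →* E :=
  FreeMonoid.lift Subtype.val

theorem word_of (P : StrictFunctor E N.Free) (A : TotalPlace P) :
    word P (FreeMonoid.of A) = A.1 := FreeMonoid.lift_eval_of _ _

theorem ofPlace_mul_ne_one (p : N.Place) (a : N.Free) : ofPlace p * a ≠ 1 :=
  List.cons_ne_nil _ _

theorem ofPlace_mul_inj {p q : N.Place} {a b : N.Free} (h : ofPlace p * a = ofPlace q * b) :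
    p = q ∧ a = b := List.cons_eq_cons.1 h

variable {P : StrictFunctor E N.Free}

/-- The projection of an object is a word of places, and this word dictates how the object splits
into letters. Splitting off the first place lifts by `obj_mul`, and the splitting is unique by
`obj_inj`, which applies because the projected words of places can be compared letter by letter. -/
theorem word_bijective (U : UniqueLifting P) : Function.Bijective (word P) := by
  constructor
  · intro w
    induction w using FreeMonoid.recOn with
    | one =>
      intro w'
      cases w' using FreeMonoid.casesOn with
      | one => intro; rfl
      | of_mul A w' =>
        intro h
        obtain ⟨p, hp⟩ := A.2
        have := congrArg P.obj h
        rw [map_one, map_mul, word_of, P.obj_one, P.obj_mul, hp] at this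
        -- A nonempty word of objects projects to a nonempty word of places, hence cannot give the
        -- unit.
        exact (ofPlace_mul_ne_one _ _ this.symm).elim
    | of_mul A w ih =>
      intro w'
      obtain ⟨p, hp⟩ := A.2
      cases w' using FreeMonoid.casesOn with
      | one =>
        intro h
        have := congrArg P.obj h
        rw [map_one, map_mul, word_of, P.obj_one, P.obj_mul, hp] at this
        exact (ofPlace_mul_ne_one _ _ this).elim
      | of_mul A' w' =>
        intro h
        obtain ⟨p', hp'⟩ := A'.2
        rw [map_mul, map_mul, word_of, word_of] at h
        have := congrArg P.obj h
        rw [P.obj_mul, P.obj_mul, hp, hp'] at this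
        obtain ⟨rfl, hw⟩ := ofPlace_mul_inj this
        obtain ⟨hA, hB⟩ := U.obj_inj _ _ _ _ h (hp.trans hp'.symm) hw
        rw [ih hB, Subtype.ext hA]
  · suffices ∀ (a : N.Free) (A : E), P.obj A = a → ∃ w, word P w = A from fun A => this _ A rfl
    refine free_induction ?_ ?_
    · intro A hA
      exact ⟨1, (map_one _).trans (U.obj_one A hA).symm⟩
    · intro p a ih A hA
      obtain ⟨B, C, rfl, hB, hC⟩ := U.obj_mul A _ _ hA
      obtain ⟨w, rfl⟩ := ih C hC
      exact ⟨FreeMonoid.of ⟨B, p, hB⟩ * w, by rw [map_mul, word_of]⟩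

variable (U : UniqueLifting P)

/-- The words of objects over single places are the objects. -/
noncomputable def wordEquiv : FreeMonoid (TotalPlace P) ≃ E :=
  Equiv.ofBijective (word P) U.word_bijective

/-- The net of the objects over single places and the morphisms over generating morphisms. -/
noncomputable def net : PetriNet.{u} where
  Place := TotalPlace P
  Trans := {φ : Arr E // ∃ t : N.Trans, P.arr φ = gen t}
  src φ := U.wordEquiv.symm φ.1.src
  tgt φ := U.wordEquiv.symm φ.1.tgt

/-- The interpretation of the free category on this net. -/
noncomputable def realize : StrictFunctor U.net.Free E :=
  PetriNet.lift (N := U.net) (fun A => A.1) fun φ =>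
    eqToHom (U.wordEquiv.apply_symm_apply φ.1.src) ≫ φ.1.hom ≫
      eqToHom (U.wordEquiv.apply_symm_apply φ.1.tgt).symm

theorem realize_obj_ofPlace (A : U.net.Place) : U.realize.obj (ofPlace A) = A.1 :=
  lift_obj_ofPlace (N := U.net) _ _ A

theorem realize_arr_gen (φ : U.net.Trans) : U.realize.arr (gen φ) = φ.1 :=
  (lift_arr_gen (N := U.net) _ _ φ).trans
    ((Arr.of_eqToHom_comp _ _).trans (Arr.of_comp_eqToHom _ _))

/-- On objects, `realize` is `word` by definition. -/
theorem realize_obj_bijective : Function.Bijective U.realize.obj := U.word_bijective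

/-- The projection of the free category on the net to the base. -/
noncomputable def down : StrictFunctor U.net.Free N.Free := U.realize.comp P

/-- The morphisms that are put together from lifts of generators in the way prescribed by an
expression. -/
def lifts : ∀ {a b : N.Free}, Term N a b → Set (Arr U.net.Free)
  | _, _, .id a => {h | ∃ A, U.down.obj A = a ∧ h = Arr.of (𝟙 A)}
  | _, _, .comp f g => {h | ∃ (A B C : U.net.Free) (k : A ⟶ B) (l : B ⟶ C),
      Arr.of k ∈ lifts f ∧ Arr.of l ∈ lifts g ∧ h = Arr.of (k ≫ l)}
  | _, _, .tensor f g => {h | ∃ k ∈ lifts f, ∃ l ∈ lifts g, h = k * l}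
  | _, _, .braid a b => {h | ∃ A B, U.down.obj A = a ∧ U.down.obj B = b ∧
      h = Arr.of (StrictSymmMon.braid A B)}
  | _, _, .gen t => {h | ∃ φ : U.net.Trans, P.arr φ.1 = PetriNet.gen t ∧ h = PetriNet.gen φ}

theorem down_arr_gen (φ : U.net.Trans) : U.down.arr (gen φ) = P.arr φ.1 := by
  rw [down, StrictFunctor.arr_comp_arr, realize_arr_gen]

/-- With `eq_of_mem` and `exists_mem`, this shows that `realize` restricts to a bijection from
`lifts f` to the fibre of `P` over the morphism `f.hom`. -/
theorem down_arr_of_mem {a b : N.Free} (f : Term N a b) :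
    ∀ h ∈ U.lifts f, U.down.arr h = Arr.of f.hom := by
  induction f with
  | id a =>
    rintro _ ⟨A, rfl, rfl⟩
    exact U.down.arr_id A
  | comp f g ih ih' =>
    rintro _ ⟨A, B, C, k, l, hk, hl, rfl⟩
    rw [U.down.arr_comp]
    exact Arr.comp_congr (ih _ hk) (ih' _ hl)
  | tensor f g ih ih' =>
    rintro _ ⟨k, hk, l, hl, rfl⟩
    rw [U.down.arr_mul, ih _ hk, ih' _ hl]
    rfl
  | braid a b =>
    rintro _ ⟨A, B, rfl, rfl, rfl⟩
    exact U.down.arr_braid A B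
  | gen t =>
    rintro _ ⟨φ, hφ, rfl⟩
    rw [down_arr_gen, hφ]
    rfl

/-- This is the uniqueness half of unique lifting. Two members of `lifts f` are composed in the same
shape from parts with the same projections, so equality in `E` splits into equalities of the parts.
-/
theorem eq_of_mem {a b : N.Free} (f : Term N a b) :
    ∀ h ∈ U.lifts f, ∀ h' ∈ U.lifts f, U.realize.arr h = U.realize.arr h' → h = h' := by
  induction f with
  | id a =>
    rintro _ ⟨A, -, rfl⟩ _ ⟨A', -, rfl⟩ h
    have e : A = A' := U.realize_obj_bijective.1 (congrArg Arr.src h)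
    rw [e]
  | comp f g ih ih' =>
    rintro _ ⟨A, B, C, k, l, hk, hl, rfl⟩ _ ⟨A', B', C', k', l', hk', hl', rfl⟩ h
    rw [U.realize.arr_comp, U.realize.arr_comp] at h
    -- `comp_inj` requires the factors to have equal projections; both `k` and `k'` lie over
    -- `f.hom`, both `l` and `l'` over `g.hom`.
    obtain ⟨e, e'⟩ := U.comp_inj _ _ _ _ _ _ _ _ _ _ h
      ((U.down_arr_of_mem f _ hk).trans (U.down_arr_of_mem f _ hk').symm)
      ((U.down_arr_of_mem g _ hl).trans (U.down_arr_of_mem g _ hl').symm)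
    exact Arr.comp_congr (ih _ hk _ hk' e) (ih' _ hl _ hl' e')
  | tensor f g ih ih' =>
    rintro _ ⟨k, hk, l, hl, rfl⟩ _ ⟨k', hk', l', hl', rfl⟩ h
    rw [U.realize.arr_mul, U.realize.arr_mul] at h
    obtain ⟨e, e'⟩ := U.tensor_inj _ _ _ _ h
      ((U.down_arr_of_mem f _ hk).trans (U.down_arr_of_mem f _ hk').symm)
      ((U.down_arr_of_mem g _ hl).trans (U.down_arr_of_mem g _ hl').symm)
    rw [ih _ hk _ hk' e, ih' _ hl _ hl' e']
  | braid a b =>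
    rintro _ ⟨A, B, hA, hB, rfl⟩ _ ⟨A', B', hA', hB', rfl⟩ h
    have e : U.realize.obj (A * B) = U.realize.obj (A' * B') := congrArg Arr.src h
    rw [U.realize.obj_mul, U.realize.obj_mul] at e
    obtain ⟨e, e'⟩ := U.obj_inj _ _ _ _ e (hA.trans hA'.symm) (hB.trans hB'.symm)
    rw [U.realize_obj_bijective.1 e, U.realize_obj_bijective.1 e']
  | gen t =>
    rintro _ ⟨φ, -, rfl⟩ _ ⟨φ', -, rfl⟩ h
    rw [realize_arr_gen, realize_arr_gen] at h
    rw [Subtype.ext h]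

/-- This is the existence half of unique lifting: the morphism is decomposed along `f` down to
morphisms over generators, which are transitions of the net. -/
theorem exists_mem {a b : N.Free} (f : Term N a b) :
    ∀ φ : Arr E, P.arr φ = Arr.of f.hom → ∃ h ∈ U.lifts f, U.realize.arr h = φ := by
  induction f with
  | id a =>
    intro φ hφ
    obtain ⟨A, hA, rfl⟩ := U.id φ a hφ
    obtain ⟨A, rfl⟩ := U.realize_obj_bijective.2 A
    exact ⟨_, ⟨A, hA, rfl⟩, U.realize.arr_id A⟩
  | comp f g ih ih' =>
    intro φ hφ
    obtain ⟨A, B, C, k, l, hk, hl, rfl⟩ := U.comp φ _ _ _ f.hom g.hom hφ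
    obtain ⟨⟨A', B', k'⟩, hk', ek⟩ := ih _ hk
    obtain ⟨⟨B'', C', l'⟩, hl', el⟩ := ih' _ hl
    -- The two lifts are found independently of each other. They are composable because their middle
    -- objects have the same image under `realize`.
    obtain rfl : B' = B'' := U.realize_obj_bijective.1
      ((congrArg Arr.tgt ek).trans (congrArg Arr.src el).symm)
    exact ⟨_, ⟨A', B', C', k', l', hk', hl', rfl⟩,
      (U.realize.arr_comp k' l').trans (Arr.comp_congr ek el)⟩
  | tensor f g ih ih' =>
    intro φ hφ
    obtain ⟨k, l, hk, hl, rfl⟩ := U.tensor φ (Arr.of f.hom) (Arr.of g.hom) hφ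
    obtain ⟨k', hk', rfl⟩ := ih _ hk
    obtain ⟨l', hl', rfl⟩ := ih' _ hl
    exact ⟨_, ⟨k', hk', l', hl', rfl⟩, U.realize.arr_mul k' l'⟩
  | braid a b =>
    intro φ hφ
    obtain ⟨A, B, hA, hB, rfl⟩ := U.braid φ a b hφ
    obtain ⟨A, rfl⟩ := U.realize_obj_bijective.2 A
    obtain ⟨B, rfl⟩ := U.realize_obj_bijective.2 B
    exact ⟨_, ⟨A, B, hA, hB, rfl⟩, U.realize.arr_braid A B⟩
  | gen t =>
    intro φ hφ
    exact ⟨_, ⟨⟨φ, t, hφ⟩, hφ, rfl⟩, U.realize_arr_gen _⟩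

/-- Related expressions denote the same morphism, so `realize` maps both sets bijectively to the
same fibre of `P`, and an inclusion between them has to be an equality. For each axiom it thus
suffices to treat the easier direction. -/
theorem lifts_eq_of_subset {a b a' b' : N.Free} {f : Term N a b} {g : Term N a' b'}
    (hr : Rel N f g) (h : U.lifts f ⊆ U.lifts g) : U.lifts f = U.lifts g := by
  refine Set.Subset.antisymm h fun k hk => ?_
  have e : Arr.of f.hom = Arr.of g.hom :=
    Arr.of_eq_of hr.endpoints.1 hr.endpoints.2 (mk_heq hr)
  obtain ⟨l, hl, hlk⟩ := U.exists_mem f (U.realize.arr k) ((U.down_arr_of_mem g k hk).trans e.symm)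
  rw [← U.eq_of_mem g _ (h hl) _ hk hlk]
  exact hl

theorem obj_eq_one {A : U.net.Free} (h : U.down.obj A = 1) : A = 1 :=
  U.realize_obj_bijective.1 ((U.obj_one _ h).trans U.realize.obj_one.symm)

theorem obj_mul_inj {A B A' B' : U.net.Free} (h : A * B = A' * B')
    (hA : U.down.obj A = U.down.obj A') (hB : U.down.obj B = U.down.obj B') :
    A = A' ∧ B = B' := by
  have e := congrArg U.realize.obj h
  rw [U.realize.obj_mul, U.realize.obj_mul] at e
  obtain ⟨e, e'⟩ := U.obj_inj _ _ _ _ e hA hB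
  exact ⟨U.realize_obj_bijective.1 e, U.realize_obj_bijective.1 e'⟩

theorem exists_obj_mul {A : U.net.Free} {b c : N.Free} (h : U.down.obj A = b * c) :
    ∃ B C, A = B * C ∧ U.down.obj B = b ∧ U.down.obj C = c := by
  obtain ⟨B, C, e, hB, hC⟩ := U.obj_mul _ _ _ h
  obtain ⟨B, rfl⟩ := U.realize_obj_bijective.2 B
  obtain ⟨C, rfl⟩ := U.realize_obj_bijective.2 C
  exact ⟨B, C, U.realize_obj_bijective.1 (e.trans (U.realize.obj_mul B C).symm), hB, hC⟩

/-- The hexagon contains a formal identity along associativity, which lifts to an identity. -/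
theorem id_mem_lifts_ofEq {a b : N.Free} (h : a = b) {A : U.net.Free} (hA : U.down.obj A = a) :
    Arr.of (𝟙 A) ∈ U.lifts (Term.ofEq h) := by
  subst h; exact ⟨A, hA, rfl⟩

theorem src_of_mem {a b : N.Free} {f : Term N a b} {h : Arr U.net.Free} (hh : h ∈ U.lifts f) :
    U.down.obj h.src = a := congrArg Arr.src (U.down_arr_of_mem f h hh)

theorem tgt_of_mem {a b : N.Free} {f : Term N a b} {h : Arr U.net.Free} (hh : h ∈ U.lifts f) :
    U.down.obj h.tgt = b := congrArg Arr.tgt (U.down_arr_of_mem f h hh)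

/-- The set of lifts depends only on the morphism given by an expression. -/
theorem lifts_eq_of_rel {a b a' b' : N.Free} {f : Term N a b} {g : Term N a' b'}
    (h : Rel N f g) : U.lifts f = U.lifts g := by
  induction h with
  | refl => rfl
  | symm _ ih => exact ih.symm
  | trans _ _ ih ih' => exact ih.trans ih'
  | comp_congr _ _ ih ih' => simp only [lifts, ih, ih']
  | tensor_congr _ _ ih ih' => simp only [lifts, ih, ih']
  | id_comp f =>
    refine U.lifts_eq_of_subset (Rel.id_comp f) ?_
    rintro _ ⟨A, B, C, k, l, ⟨A', -, hk⟩, hl, rfl⟩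
    cases hk
    rwa [Category.id_comp]
  | comp_id f =>
    refine U.lifts_eq_of_subset (Rel.comp_id f) ?_
    rintro _ ⟨A, B, C, k, l, hk, ⟨A', -, hl⟩, rfl⟩
    cases hl
    rwa [Category.comp_id]
  | assoc f g h =>
    refine U.lifts_eq_of_subset (Rel.assoc f g h) ?_
    rintro _ ⟨A, B, C, x, l, ⟨A', B', C', k, m, hk, hm, hx⟩, hl, rfl⟩
    cases hx
    exact ⟨_, _, _, k, m ≫ l, hk, ⟨_, _, _, m, l, hm, hl, rfl⟩, by rw [Category.assoc]⟩
  | tensor_id a b =>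
    refine U.lifts_eq_of_subset (Rel.tensor_id a b) ?_
    rintro _ ⟨_, ⟨A, hA, rfl⟩, _, ⟨B, hB, rfl⟩, rfl⟩
    exact ⟨A * B, by rw [U.down.obj_mul, hA, hB], Arr.of_tensor_id A B⟩
  | tensor_comp f g f' g' =>
    refine U.lifts_eq_of_subset (Rel.tensor_comp f g f' g') ?_
    rintro _ ⟨_, ⟨A, B, C, k, l, hk, hl, rfl⟩, _, ⟨A', B', C', k', l', hk', hl', rfl⟩, rfl⟩
    exact ⟨_, _, _, StrictSymmMon.tensor k k', StrictSymmMon.tensor l l', ⟨_, hk, _, hk', rfl⟩,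
      ⟨_, hl, _, hl', rfl⟩, by rw [Arr.mul_def, StrictSymmMon.tensor_comp]⟩
  | tensor_assoc f g h =>
    refine U.lifts_eq_of_subset (Rel.tensor_assoc f g h) ?_
    rintro _ ⟨_, ⟨k, hk, l, hl, rfl⟩, m, hm, rfl⟩
    exact ⟨k, hk, _, ⟨l, hl, m, hm, rfl⟩, mul_assoc k l m⟩
  | unit_tensor f =>
    refine U.lifts_eq_of_subset (Rel.unit_tensor f) ?_
    rintro _ ⟨_, ⟨A, hA, rfl⟩, l, hl, rfl⟩
    -- An object over the unit is the unit, so the lifted identity really is the identity of `1`.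
    cases U.obj_eq_one hA
    exact (one_mul l).symm ▸ hl
  | tensor_unit f =>
    refine U.lifts_eq_of_subset (Rel.tensor_unit f) ?_
    rintro _ ⟨l, hl, _, ⟨A, hA, rfl⟩, rfl⟩
    cases U.obj_eq_one hA
    exact (mul_one l).symm ▸ hl
  | braid_natural f g =>
    refine U.lifts_eq_of_subset (Rel.braid_natural f g) ?_
    rintro _ ⟨A, B, C, x, y, ⟨⟨A₁, A₂, k⟩, hk, ⟨B₁, B₂, l⟩, hl, hx⟩, ⟨B', C', hB, hC, hy⟩, rfl⟩
    cases hx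
    -- The middle object is decomposed twice, as the target of the tensor product and as the source
    -- of the braiding. The factors have equal projections, hence are equal.
    obtain ⟨rfl, rfl⟩ := U.obj_mul_inj (congrArg Arr.src hy :)
      ((U.tgt_of_mem hk).trans hB.symm) ((U.tgt_of_mem hl).trans hC.symm)
    cases hy
    exact ⟨_, _, _, StrictSymmMon.braid A₁ B₁, StrictSymmMon.tensor l k,
      ⟨A₁, B₁, U.src_of_mem hk, U.src_of_mem hl, rfl⟩, ⟨_, hl, _, hk, rfl⟩,
      by rw [StrictSymmMon.braid_natural]⟩
  | braid_braid a b =>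
    refine U.lifts_eq_of_subset (Rel.braid_braid a b) ?_
    rintro _ ⟨A, B, C, x, y, ⟨A₁, B₁, hA, hB, hx⟩, ⟨B₂, A₂, hB', hA', hy⟩, rfl⟩
    cases hx
    obtain ⟨rfl, rfl⟩ := U.obj_mul_inj (congrArg Arr.src hy :)
      (hB.trans hB'.symm) (hA.trans hA'.symm)
    cases hy
    exact ⟨A₁ * B₁, by rw [U.down.obj_mul, hA, hB], by rw [StrictSymmMon.braid_braid]⟩
  | hexagon a b c =>
    refine U.lifts_eq_of_subset (Rel.hexagon a b c) ?_
    rintro _ ⟨A, D, hA, hD, rfl⟩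
    -- The lifted braiding only provides an object `D` over `b * c`; it has to be split before the
    -- hexagon identity can be used.
    obtain ⟨B, C, rfl, hB, hC⟩ := U.exists_obj_mul hD
    refine ⟨_, _, _, StrictSymmMon.tensor (StrictSymmMon.braid A B) (𝟙 C),
      eqToHom (mul_assoc B A C) ≫ StrictSymmMon.tensor (𝟙 B) (StrictSymmMon.braid A C),
      ⟨_, ⟨A, B, hA, hB, rfl⟩, _, ⟨C, hC, rfl⟩, rfl⟩,
      ⟨_, _, _, eqToHom (mul_assoc B A C), _, ?_, ⟨_, ⟨B, hB, rfl⟩, _, ⟨A, C, hA, hC, rfl⟩, rfl⟩,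
        rfl⟩,
      Arr.of_eq_of (mul_assoc _ _ _).symm (mul_assoc _ _ _) (StrictSymmMon.hexagon A B C)⟩
    rw [Arr.of_eqToHom]
    exact U.id_mem_lifts_ofEq _ (by rw [U.down.obj_mul, U.down.obj_mul, hA, hB, hC])

/-- The expression sought is the projection of `f`, generator by generator. So the sets `lifts g`
together exhaust the free category on the net. -/
theorem exists_lifts {A B : U.net.Free} (f : Term U.net A B) :
    ∃ (a b : N.Free) (g : Term N a b), Arr.of f.hom ∈ U.lifts g := by
  induction f with
  | id A => exact ⟨_, _, Term.id (U.down.obj A), A, rfl, rfl⟩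
  | comp f g ih ih' =>
    obtain ⟨a, b, k, hk⟩ := ih
    obtain ⟨b', c, l, hl⟩ := ih'
    obtain rfl : b = b' := (U.tgt_of_mem hk).symm.trans (U.src_of_mem hl)
    exact ⟨_, _, k.comp l, _, _, _, f.hom, g.hom, hk, hl, rfl⟩
  | tensor f g ih ih' =>
    obtain ⟨a, b, k, hk⟩ := ih
    obtain ⟨c, d, l, hl⟩ := ih'
    exact ⟨_, _, k.tensor l, _, hk, _, hl, rfl⟩
  | braid A B => exact ⟨_, _, Term.braid (U.down.obj A) (U.down.obj B), A, B, rfl, rfl, rfl⟩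
  | gen φ =>
    obtain ⟨t, ht⟩ := φ.2
    exact ⟨_, _, Term.gen t, φ, ht, rfl⟩

/-- A category with unique lifting over a free category is free. -/
theorem realize_arr_bijective : Function.Bijective U.realize.arr := by
  constructor
  · intro h h' e
    obtain ⟨f, hf⟩ := exists_term h
    obtain ⟨f', hf'⟩ := exists_term h'
    obtain ⟨a, b, g, hg⟩ := U.exists_lifts f
    obtain ⟨a', b', g', hg'⟩ := U.exists_lifts f'
    rw [hf] at hg
    rw [hf'] at hg'
    -- Morphisms with the same image in `E` have the same projection, so the expressions `g` and
    -- `g'` denote the same morphism. Then `h` and `h'` lie in a common set of lifts, on which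
    -- `realize` is injective.
    have hgg : Arr.of g.hom = Arr.of g'.hom := by
      rw [← U.down_arr_of_mem g h hg, ← U.down_arr_of_mem g' h' hg']
      exact congrArg P.arr e
    have ha : a = a' := congrArg Arr.src hgg
    have hb : b = b' := congrArg Arr.tgt hgg
    subst ha hb
    rw [← U.lifts_eq_of_rel (Quotient.exact (Arr.eq_of_of_eq hgg))] at hg'
    exact U.eq_of_mem g h hg h' hg' e
  · intro φ
    obtain ⟨f, hf⟩ := exists_term (P.arr φ)
    obtain ⟨h, -, hh⟩ := U.exists_mem f φ hf.symm
    exact ⟨h, hh⟩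

/-- The isomorphism between the free category on the net and the total category. -/
noncomputable def freeIso : U.net.free ≅ SSMCat.mk E :=
  U.realize.isoOfBijective U.realize_arr_bijective

end UniqueLifting

end GuardedNets

namespace GuardedNets

open StrictSymmMon PetriNet

/-! ### Erasings of generators in terms of places and transitions -/

/-- The subnets `a` and `b` of `M` have complementary transitions, and `b` has all the places. -/
structure Complementary {M Mw MK : PetriNet.{u}} (a : Inclusion Mw M) (b : Inclusion MK M) :
    Prop where
  place : Function.Surjective b.place
  cover : ∀ t, (∃ s, a.trans s = t) ∨ ∃ s, b.trans s = t
  disjoint : ∀ s r, a.trans s ≠ b.trans r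

/-- A commutative monoid `A`, as a symmetric strict monoidal category with the elements of `A` as
objects and as morphisms between any two objects. -/
def Labels (A : Type u) : Type u := A

/-! ### Label categories: strict functors to them are labellings of nets. -/

namespace Labels

variable {A : Type u} [CommMonoid A]

instance : Monoid (Labels A) := inferInstanceAs (Monoid A)

instance : Category.{u} (Labels A) where
  Hom _ _ := A
  id _ := (1 : A)
  comp f g := (f * g : A)
  id_comp f := one_mul (M := A) f
  comp_id f := mul_one (M := A) f
  assoc f g h := mul_assoc (G := A) f g h

/-- An element, as a morphism between given objects. -/
def hom (a b : Labels A) (x : A) : a ⟶ b := x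

instance : StrictSymmMon (Labels A) where
  tensor f g := (f * g : A)
  tensor_id _ _ := one_mul (1 : A)
  tensor_comp f g f' g' := mul_mul_mul_comm (G := A) f g f' g'
  tensor_assoc f g h := heq_of_eq (mul_assoc (G := A) f g h)
  unit_tensor f := heq_of_eq (one_mul (M := A) f)
  tensor_unit f := heq_of_eq (mul_one (M := A) f)
  braid _ _ := (1 : A)
  braid_natural f g := (mul_one (M := A) _).trans
    ((mul_comm (G := A) f g).trans (one_mul (M := A) _).symm)
  braid_braid _ _ := one_mul (1 : A)
  hexagon a b c := by
    refine heq_of_eq (?_ : (1 : A) = (1 * 1) * (eqToHom (mul_assoc b a c) * (1 * 1 : A) : A))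
    -- All braidings and identities are labelled `1`, so the hexagon only needs that transport is
    -- labelled `1` as well.
    have : ∀ {a b : Labels A} (h : a = b), (eqToHom h : A) = 1 := fun h => by subst h; rfl
    rw [this, one_mul, one_mul, one_mul]

/-- The functor that assigns given elements to the places and the transitions. -/
def functor {N : PetriNet.{u}} (o : N.Place → A) (m : N.Trans → A) :
    StrictFunctor N.Free (Labels A) :=
  PetriNet.lift (D := Labels A) o fun t => hom _ _ (m t)

variable {N : PetriNet.{u}}

theorem functor_obj_ofPlace (o : N.Place → A) (m : N.Trans → A) (p : N.Place) :
    (functor o m).obj (ofPlace p) = o p := lift_obj_ofPlace (D := Labels A) _ _ p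

theorem functor_map_gen (o : N.Place → A) (m : N.Trans → A) (t : N.Trans) :
    (show A from ((functor o m).arr (gen t)).hom) = m t := rfl

theorem hom_eq_of_eq {φ ψ : Arr (Labels A)} (h : φ = ψ) :
    (show A from φ.hom) = (show A from ψ.hom) := by subst h; rfl

/-- Functors with equal labels on places agree on a transition if its labels agree. -/
theorem arr_eq {φ ψ : Arr (Labels A)} (hs : φ.src = ψ.src) (ht : φ.tgt = ψ.tgt)
    (h : (show A from φ.hom) = (show A from ψ.hom)) : φ = ψ := by
  obtain ⟨a, b, f⟩ := φ
  obtain ⟨a', b', f'⟩ := ψ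
  cases hs
  cases ht
  cases (show f = f' from h)
  rfl

theorem inclusion_comp_functor {M : PetriNet.{u}} (i : Inclusion M N) (o : N.Place → A)
    (m : N.Trans → A) :
    i.functor.comp (functor o m) = functor (fun p => o (i.place p)) fun t => m (i.trans t) := by
  have hp : ∀ p : M.Place, (i.functor.comp (functor o m)).obj (ofPlace p) =
      (functor (fun p => o (i.place p)) fun t => m (i.trans t)).obj (ofPlace p) := fun p => by
    rw [i.comp_obj_ofPlace, functor_obj_ofPlace, functor_obj_ofPlace]
  have ho : ∀ a : M.Free, (i.functor.comp (functor o m)).obj a =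
      (functor (fun p => o (i.place p)) fun t => m (i.trans t)).obj a :=
    free_induction (by rw [StrictFunctor.obj_one, StrictFunctor.obj_one]) fun p a ih => by
      rw [StrictFunctor.obj_mul, StrictFunctor.obj_mul, hp, ih]
  refine functor_ext hp fun t => arr_eq (ho _) (ho _) ?_
  exact (hom_eq_of_eq (i.comp_arr_gen (functor o m) t)).trans (functor_map_gen o m _)

/-- Together with `exists_eq_functor`, this identifies strict functors to `Labels A` with pairs of
arbitrary functions on places and transitions. A transition may carry any label, since every hom-set
of `Labels A` is all of `A`. -/
theorem functor_injective {o o' : N.Place → A} {m m' : N.Trans → A}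
    (h : functor o m = functor o' m') : o = o' ∧ m = m' := by
  constructor
  · funext p
    rw [← functor_obj_ofPlace o m, h, functor_obj_ofPlace]
  · funext t
    exact hom_eq_of_eq (congrArg (fun F : StrictFunctor N.Free (Labels A) => F.arr (gen t)) h)

theorem exists_eq_functor (F : StrictFunctor N.Free (Labels A)) :
    ∃ o m, F = functor o m := by
  let o : N.Place → A := fun p => F.obj (ofPlace p)
  let m : N.Trans → A := fun t => (F.arr (gen t)).hom
  have hp : ∀ p : N.Place, F.obj (ofPlace p) = (functor o m).obj (ofPlace p) := fun p =>
    (functor_obj_ofPlace o m p).symm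
  have ho : ∀ a : N.Free, F.obj a = (functor o m).obj a :=
    free_induction (by rw [StrictFunctor.obj_one, StrictFunctor.obj_one]) fun p a ih => by
      rw [StrictFunctor.obj_mul, StrictFunctor.obj_mul, hp, ih]
  exact ⟨o, m, functor_ext hp fun t => arr_eq (ho _) (ho _) rfl⟩

end Labels

/-! ### Pushouts of free categories and complementary subnets. -/

section

variable {M Mw MK : PetriNet.{u}} {a : Inclusion Mw M} {b : Inclusion MK M}
  {k : Inclusion Mw.bar MK}

/-- The strict functor of an inclusion, as a morphism between free categories. -/
def PetriNet.Inclusion.free (i : Inclusion Mw M) : Mw.free ⟶ M.free := i.functor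

/-- Generating morphisms are equivalence classes of expressions, so distinct transitions have to be
told apart by an invariant: the labelling that is trivial at `t` and nontrivial at every other
transition. -/
theorem gen_injective {N : PetriNet.{u}} : Function.Injective (gen (N := N)) := by
  classical
  intro t t' h
  let m : N.Trans → ULift.{u} (Multiplicative ℕ) := fun s =>
    if s = t then 1 else ⟨Multiplicative.ofAdd 1⟩
  have e := Labels.hom_eq_of_eq (congrArg (Labels.functor (fun _ => 1) m).arr h)
  have e : m t = m t' := e
  by_contra hne
  simp only [m, if_true, if_neg (Ne.symm hne)] at e
  exact absurd (congrArg (fun x => Multiplicative.toAdd x.down) e) (by simp)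

/-- The universal property is tested on labellings in a nontrivial commutative monoid. Uniqueness of
induced functors says that a labelling is determined by its restrictions, which forces the subnets
to cover `M`; existence says that unrelated labels on the transitions of the two subnets can be
glued, which forces these transitions to be disjoint. -/
theorem Complementary.of_isPushout
    (h : IsPushout Mw.barInclusion.free k.free a.free b.free) : Complementary a b := by
  classical
  let A := ULift.{u} (Multiplicative ℕ)
  let c : A := ⟨Multiplicative.ofAdd 1⟩
  have hc : c ≠ 1 := fun h => absurd (congrArg (fun x : A => Multiplicative.toAdd x.down) h)
    (by simp [c])
  -- Commutativity of the square, evaluated at a place: the places of `Mw` are among those of `MK`.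
  -- Hence in `key` agreement of `o` and `o'` need only be assumed on the places of `MK`.
  have hab : ∀ p : Mw.Place, a.place p = b.place (k.place p) := fun p => by
    have w : Mw.barInclusion.functor.comp a.functor = k.functor.comp b.functor := h.w
    have e := congrArg (fun F : StrictFunctor Mw.bar.Free M.Free =>
      F.obj (ofPlace (N := Mw.bar) p)) w
    have e := (Mw.barInclusion.comp_obj_ofPlace a.functor p).symm.trans
      (e.trans (k.comp_obj_ofPlace b.functor p))
    rw [Inclusion.functor_obj_ofPlace, Inclusion.functor_obj_ofPlace] at e
    exact ofPlace_injective e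
  have key : ∀ (o o' : M.Place → A) (m m' : M.Trans → A), (∀ p, o (b.place p) = o' (b.place p)) →
      (∀ t, m (a.trans t) = m' (a.trans t)) → (∀ t, m (b.trans t) = m' (b.trans t)) →
      o = o' ∧ m = m' := by
    intro o o' m m' ho hm hm'
    refine Labels.functor_injective (h.hom_ext (W := SSMCat.mk (Labels A))
      (k := (Labels.functor o m).toHom) (l := (Labels.functor o' m').toHom) ?_ ?_)
    · change a.functor.comp (Labels.functor o m) = a.functor.comp (Labels.functor o' m')
      rw [Labels.inclusion_comp_functor, Labels.inclusion_comp_functor]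
      simp only [hab, ho, hm]
    · change b.functor.comp (Labels.functor o m) = b.functor.comp (Labels.functor o' m')
      rw [Labels.inclusion_comp_functor, Labels.inclusion_comp_functor]
      simp only [ho, hm']
  refine ⟨fun p => ?_, fun t => ?_, fun s r e => ?_⟩
  · by_contra hp
    -- A place outside the image of `b` could be relabelled by `c` without changing either
    -- restriction. The same trick with transitions proves the covering.
    have := congrFun (key (fun q => if q ∈ Set.range b.place then 1 else c) (fun _ => 1)
      (fun _ => 1) (fun _ => 1) (fun q => if_pos ⟨q, rfl⟩) (fun _ => rfl) fun _ => rfl).1 p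
    exact hc ((if_neg hp).symm.trans this)
  · by_contra ht
    have := congrFun (key (fun _ => 1) (fun _ => 1)
      (fun t => if t ∈ Set.range a.trans ∪ Set.range b.trans then 1 else c) (fun _ => 1)
      (fun _ => rfl) (fun t => if_pos (Or.inl ⟨t, rfl⟩)) fun t => if_pos (Or.inr ⟨t, rfl⟩)).2 t
    exact hc ((if_neg ht).symm.trans this)
  -- Transitions of `Mw` are labelled `1` and those of `MK` are labelled `c`. These labellings agree
  -- on the net without transitions, so they glue, and a common transition would have both labels.
  · let F : StrictFunctor Mw.Free (Labels A) := Labels.functor (fun _ => 1) fun _ => 1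
    let G : StrictFunctor MK.Free (Labels A) := Labels.functor (fun _ => 1) fun _ => c
    have w : Mw.barInclusion.functor.comp F = k.functor.comp G := by
      rw [Labels.inclusion_comp_functor, Labels.inclusion_comp_functor]
      exact congrArg _ (funext fun t => t.elim)
    obtain ⟨o, m, hom_eq⟩ := Labels.exists_eq_functor
      (show StrictFunctor M.Free (Labels A) from
        h.desc (W := SSMCat.mk (Labels A)) F.toHom G.toHom w)
    have hF : a.functor.comp (Labels.functor o m) = F := by
      rw [← hom_eq]
      exact h.inl_desc (W := SSMCat.mk (Labels A)) F.toHom G.toHom w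
    have hG : b.functor.comp (Labels.functor o m) = G := by
      rw [← hom_eq]
      exact h.inr_desc (W := SSMCat.mk (Labels A)) F.toHom G.toHom w
    rw [Labels.inclusion_comp_functor] at hF hG
    have e₁ : m (a.trans s) = 1 := congrFun (Labels.functor_injective hF).2 s
    have e₂ : m (b.trans r) = c := congrFun (Labels.functor_injective hG).2 r
    exact hc (e₂.symm.trans ((congrArg m e).symm.trans e₁))

/-- By freeness of `M.Free`, a functor out of it amounts to values on generators. Each transition
lies in exactly one subnet, so its value is prescribed exactly once; all places lie in `MK`, and
`hk` with commutativity makes the values on them consistent with those on `Mw`. -/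
theorem Complementary.isPushout (h : Complementary a b)
    (hk : ∀ p : Mw.Place, b.place (k.place p) = a.place p) :
    IsPushout Mw.barInclusion.free k.free a.free b.free := by
  have w : Mw.barInclusion.functor.comp a.functor = k.functor.comp b.functor :=
    functor_ext (N := Mw.bar) (fun p => by
      refine (Mw.barInclusion.comp_obj_ofPlace a.functor p).trans
        (Eq.trans ?_ (k.comp_obj_ofPlace b.functor p).symm)
      rw [Inclusion.functor_obj_ofPlace, Inclusion.functor_obj_ofPlace]
      exact congrArg ofPlace (hk p).symm) fun t => t.elim
  -- Uniqueness of the induced functor: every generator of `M` comes from one of the two subnets.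
  have epi : ∀ {D : Type u} [Category.{u} D] [StrictSymmMon D] {F G : StrictFunctor M.Free D},
      a.functor.comp F = a.functor.comp G → b.functor.comp F = b.functor.comp G → F = G := by
    intro D _ _ F G ha hb
    refine functor_ext (fun p => ?_) fun t => ?_
    · obtain ⟨p, rfl⟩ := h.place p
      rw [← Inclusion.functor_obj_ofPlace]
      exact congrArg (fun H : StrictFunctor MK.Free D => H.obj (ofPlace p)) hb
    · rcases h.cover t with ⟨s, rfl⟩ | ⟨s, rfl⟩
      · rw [← Inclusion.functor_arr_gen]
        exact congrArg (fun H : StrictFunctor Mw.Free D => H.arr (gen s)) ha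
      · rw [← Inclusion.functor_arr_gen]
        exact congrArg (fun H : StrictFunctor MK.Free D => H.arr (gen s)) hb
  have desc : ∀ {D : Type u} [Category.{u} D] [StrictSymmMon D] (F : StrictFunctor Mw.Free D)
      (G : StrictFunctor MK.Free D), Mw.barInclusion.functor.comp F = k.functor.comp G →
      ∃ H : StrictFunctor M.Free D, a.functor.comp H = F ∧ b.functor.comp H = G := by
    intro D _ _ F G hFG
    let e : MK.Place ≃ M.Place := Equiv.ofBijective b.place ⟨b.place_injective, h.place⟩
    let o : M.Place → D := fun p => G.obj (ofPlace (e.symm p))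
    have ob : ∀ p, o (b.place p) = G.obj (ofPlace p) := fun p =>
      congrArg (fun q => G.obj (ofPlace q)) (e.symm_apply_apply p)
    -- The values on places are taken from `G` alone; on the places of `Mw` they agree with `F`
    -- because `F` and `G` agree on the net without transitions.
    have oa : ∀ p, o (a.place p) = F.obj (ofPlace p) := fun p => by
      rw [← hk, ob]
      have e := congrArg
        (fun H : StrictFunctor Mw.bar.Free D => H.obj (ofPlace (N := Mw.bar) p)) hFG
      exact ((Mw.barInclusion.comp_obj_ofPlace F p).symm.trans
        (e.trans (k.comp_obj_ofPlace G p))).symm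
    have hob : ∀ x : MK.Free, liftObj (N := M) o (FreeMonoid.map b.place x) = G.obj x :=
      free_induction (liftObj_one (N := M) o |>.trans G.obj_one.symm) fun p x ih => by
        rw [G.obj_mul, ← ih, ← ob]
        exact liftObj_mul (N := M) o (ofPlace _) _
    have hoa : ∀ x : Mw.Free, liftObj (N := M) o (FreeMonoid.map a.place x) = F.obj x :=
      free_induction (liftObj_one (N := M) o |>.trans F.obj_one.symm) fun p x ih => by
        rw [F.obj_mul, ← ih, ← oa]
        exact liftObj_mul (N := M) o (ofPlace _) _
    -- Both requirements are stated for every `t`. For each `t`, one of them is vacuous by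
    -- disjointness, and injectivity on transitions makes the other a single condition.
    have hm : ∀ t : M.Trans, ∃ m : liftObj o (M.src t) ⟶ liftObj o (M.tgt t),
        (∀ s, a.trans s = t → Arr.of m = F.arr (gen s)) ∧
        (∀ s, b.trans s = t → Arr.of m = G.arr (gen s)) := by
      intro t
      rcases h.cover t with ⟨s, rfl⟩ | ⟨s, rfl⟩
      · obtain ⟨m, hm⟩ := Arr.exists_hom (F.arr (gen s))
          (a := liftObj o (M.src (a.trans s))) (b := liftObj o (M.tgt (a.trans s)))
          (by rw [a.src_trans]; exact (hoa _).symm) (by rw [a.tgt_trans]; exact (hoa _).symm)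
        refine ⟨m, fun r hr => ?_, fun r hr => ?_⟩
        · rw [a.trans_injective hr, hm]
        · exact (h.disjoint _ _ hr.symm).elim
      · obtain ⟨m, hm⟩ := Arr.exists_hom (G.arr (gen s))
          (a := liftObj o (M.src (b.trans s))) (b := liftObj o (M.tgt (b.trans s)))
          (by rw [b.src_trans]; exact (hob _).symm) (by rw [b.tgt_trans]; exact (hob _).symm)
        refine ⟨m, fun r hr => ?_, fun r hr => ?_⟩
        · exact (h.disjoint _ _ hr).elim
        · rw [b.trans_injective hr, hm]
    choose m hma hmb using hm
    refine ⟨lift o m, functor_ext (fun p => ?_) fun t => ?_, functor_ext (fun p => ?_) fun t => ?_⟩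
    · exact (congrArg (lift o m).obj (a.functor_obj_ofPlace p)).trans
        ((lift_obj_ofPlace o m _).trans (oa p))
    · exact (congrArg (lift o m).arr (a.functor_arr_gen t)).trans (hma _ t rfl)
    · exact (congrArg (lift o m).obj (b.functor_obj_ofPlace p)).trans
        ((lift_obj_ofPlace o m _).trans (ob p))
    · exact (congrArg (lift o m).arr (b.functor_arr_gen t)).trans (hmb _ t rfl)
  refine ⟨⟨w⟩, ⟨Limits.PushoutCocone.IsColimit.mk _ (fun s => (desc _ _ s.condition).choose)
    (fun s => (desc _ _ s.condition).choose_spec.1)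
    (fun s => (desc _ _ s.condition).choose_spec.2) fun s m h₁ h₂ => ?_⟩⟩
  exact epi (h₁.trans (desc _ _ s.condition).choose_spec.1.symm)
    (h₂.trans (desc _ _ s.condition).choose_spec.2.symm)

/-- The pushout condition only concerns the underlying nets, so the semantics plays no role. -/
theorem Complementary.of_isErasing {S : Type u₂} [Category.{v₂} S] [StrictSymmMon S]
    {N Nw K : NetSem.{u} S} {subw : Subnet Nw N} {subK : Subnet K N} (h : IsErasing subw subK) :
    Complementary subw.toInclusion subK.toInclusion := by
  obtain ⟨k, hk⟩ := h
  exact .of_isPushout (k := k.toInclusion) hk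

/-- An inclusion of plain nets, as a subnet. -/
def PetriNet.Inclusion.trivial (i : Inclusion Mw M) :
    Subnet Mw.trivial M.trivial where
  toInclusion := i
  sem_eq := StrictFunctor.ext' rfl

theorem Complementary.isErasing (h : Complementary a b) : IsErasing a.trivial b.trivial := by
  -- Since `MK` has all the places of `M`, a place of `Mw` becomes a place of `MK` through the
  -- inverse of `b` on places.
  let e : MK.Place ≃ M.Place := Equiv.ofBijective b.place ⟨b.place_injective, h.place⟩
  let k : Inclusion Mw.bar MK :=
    { place := fun p => e.symm (a.place p)
      trans := PEmpty.elim
      place_injective := e.symm.injective.comp a.place_injective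
      trans_injective := fun t => t.elim
      src_trans := fun t => t.elim
      tgt_trans := fun t => t.elim }
  exact ⟨⟨k, StrictFunctor.ext' rfl⟩, h.isPushout (k := k) fun p => e.apply_symm_apply (a.place p)⟩

end

end GuardedNets

namespace GuardedNets

open StrictSymmMon PetriNet

/-! ### Restriction along an inclusion -/

/-- The square of strict functors with sides `L`, `P'`, `P`, `G` commutes and is a pullback on
morphisms. -/
structure IsRestriction {E' : Type u₁} [Category.{v₁} E'] [StrictSymmMon E']
    {E : Type u₁} [Category.{v₁} E] [StrictSymmMon E]
    {C' : Type u₂} [Category.{v₂} C'] [StrictSymmMon C']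
    {C : Type u₂} [Category.{v₂} C] [StrictSymmMon C]
    (L : StrictFunctor E' E) (P' : StrictFunctor E' C') (P : StrictFunctor E C)
    (G : StrictFunctor C' C) : Prop where
  comm : ∀ φ, P.arr (L.arr φ) = G.arr (P'.arr φ)
  exists_lift : ∀ (φ : Arr E) (g : Arr C'), P.arr φ = G.arr g → ∃ ψ, P'.arr ψ = g ∧ L.arr ψ = φ
  inj : ∀ φ ψ, P'.arr φ = P'.arr ψ → L.arr φ = L.arr ψ → φ = ψ

/-! ### Subnets induced on the nets of lifted generators. -/

namespace IsRestriction

section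

variable {E' : Type u₁} [Category.{v₁} E'] [StrictSymmMon E']
  {E : Type u₁} [Category.{v₁} E] [StrictSymmMon E]
  {C' : Type u₂} [Category.{v₂} C'] [StrictSymmMon C']
  {C : Type u₂} [Category.{v₂} C] [StrictSymmMon C]
  {L : StrictFunctor E' E} {P' : StrictFunctor E' C'} {P : StrictFunctor E C}
  {G : StrictFunctor C' C}

theorem comm_obj (h : IsRestriction L P' P G) (A : E') :
    P.obj (L.obj A) = G.obj (P'.obj A) := congrArg Arr.src (h.comm (Arr.of (𝟙 A)))

theorem obj_inj (h : IsRestriction L P' P G) {A B : E'} (hP : P'.obj A = P'.obj B)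
    (hL : L.obj A = L.obj B) : A = B :=
  Arr.of_id_injective (h.inj _ _ (by rw [P'.arr_id, P'.arr_id, hP])
    (by rw [L.arr_id, L.arr_id, hL]))

theorem exists_obj (h : IsRestriction L P' P G) (A : E) (a : C') (hA : P.obj A = G.obj a) :
    ∃ B, P'.obj B = a ∧ L.obj B = A := by
  obtain ⟨ψ, hP, hL⟩ := h.exists_lift (Arr.of (𝟙 A)) (Arr.of (𝟙 a)) (by
    rw [P.arr_id, G.arr_id, hA])
  exact ⟨ψ.src, congrArg Arr.src hP, congrArg Arr.src hL⟩

end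

variable {E' : Type u} [Category.{u} E'] [StrictSymmMon E']
  {E : Type u} [Category.{u} E] [StrictSymmMon E] {M N : PetriNet.{u}} {i : Inclusion M N}
  {L : StrictFunctor E' E} {P' : StrictFunctor E' M.Free} {P : StrictFunctor E N.Free}
  (h : IsRestriction L P' P i.functor)

/-- The inclusion on objects over single places. -/
def onPlace (A : UniqueLifting.TotalPlace P') : UniqueLifting.TotalPlace P :=
  ⟨L.obj A.1, by
    obtain ⟨p, hp⟩ := A.2
    exact ⟨i.place p, by rw [h.comm_obj, hp, i.functor_obj_ofPlace]⟩⟩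

theorem word_map_onPlace (w : FreeMonoid (UniqueLifting.TotalPlace P')) :
    UniqueLifting.word P (FreeMonoid.map h.onPlace w) = L.obj (UniqueLifting.word P' w) := by
  induction w using FreeMonoid.recOn with
  | one => exact L.obj_one.symm
  | of_mul A w ih =>
    rw [map_mul, map_mul, ih, map_mul, L.obj_mul]
    rfl

variable (U' : UniqueLifting P') (U : UniqueLifting P)

/-- Spelling an object in letters commutes with `L`. This is what makes the inputs and outputs of a
transition the same in both nets. -/
theorem wordEquiv_symm_obj (A : E') : U.wordEquiv.symm (L.obj A) =
    FreeMonoid.map h.onPlace (U'.wordEquiv.symm A) := by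
  rw [Equiv.symm_apply_eq]
  exact ((h.word_map_onPlace _).trans
    (congrArg L.obj (U'.wordEquiv.apply_symm_apply A))).symm

/-- The inclusion of nets over an inclusion of nets. -/
def inclusion : Inclusion U'.net U.net where
  place := h.onPlace
  trans φ := ⟨L.arr φ.1, by
    obtain ⟨t, ht⟩ := φ.2
    exact ⟨i.trans t, by rw [h.comm, ht, i.functor_arr_gen]⟩⟩
  place_injective A B e := by
    have e : L.obj A.1 = L.obj B.1 := congrArg Subtype.val e
    obtain ⟨p, hp⟩ := A.2
    obtain ⟨q, hq⟩ := B.2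
    -- Objects with the same image under `L` lie over the same place of `N`, hence over the same
    -- place of `M`. Joint injectivity of `L` and `P'` then applies. Transitions are treated alike,
    -- by means of `gen_injective`.
    have hpq : i.functor.obj (ofPlace p) = i.functor.obj (ofPlace q) := by
      rw [← hp, ← hq, ← h.comm_obj, ← h.comm_obj, e]
    rw [i.functor_obj_ofPlace, i.functor_obj_ofPlace] at hpq
    cases i.place_injective (ofPlace_injective hpq)
    exact Subtype.ext (h.obj_inj (hp.trans hq.symm) e)
  trans_injective φ ψ e := by
    have e : L.arr φ.1 = L.arr ψ.1 := congrArg Subtype.val e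
    obtain ⟨s, hs⟩ := φ.2
    obtain ⟨t, ht⟩ := ψ.2
    have hst : i.functor.arr (gen s) = i.functor.arr (gen t) := by
      rw [← hs, ← ht, ← h.comm, ← h.comm, e]
    rw [i.functor_arr_gen, i.functor_arr_gen] at hst
    cases i.trans_injective (gen_injective hst)
    exact Subtype.ext (h.inj _ _ (hs.trans ht.symm) e)
  src_trans φ := h.wordEquiv_symm_obj U' U φ.1.src
  tgt_trans φ := h.wordEquiv_symm_obj U' U φ.1.tgt

/-- By the pullback property, membership in the subnet can be read off from the projection alone.
The next two lemmas are the analogue for transitions and its converse. -/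
theorem exists_place (A : U.net.Place) (p : M.Place) (hA : P.obj A.1 = ofPlace (i.place p)) :
    ∃ B, (h.inclusion U' U).place B = A := by
  obtain ⟨B, hB, hBA⟩ := h.exists_obj A.1 (ofPlace p) (by rw [hA, i.functor_obj_ofPlace])
  exact ⟨⟨B, p, hB⟩, Subtype.ext hBA⟩

theorem exists_trans (φ : U.net.Trans) (t : M.Trans) (hφ : P.arr φ.1 = gen (i.trans t)) :
    ∃ ψ, (h.inclusion U' U).trans ψ = φ := by
  obtain ⟨ψ, hψ, hψφ⟩ := h.exists_lift φ.1 (gen t) (by rw [hφ, i.functor_arr_gen])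
  exact ⟨⟨ψ, t, hψ⟩, Subtype.ext hψφ⟩

theorem arr_trans (ψ : U'.net.Trans) :
    ∃ t, P.arr ((h.inclusion U' U).trans ψ).1 = gen (i.trans t) := by
  obtain ⟨t, ht⟩ := ψ.2
  exact ⟨t, (h.comm ψ.1).trans (by rw [ht, i.functor_arr_gen])⟩

theorem inclusion_comp_realize :
    (h.inclusion U' U).functor.comp U.realize = U'.realize.comp L := by
  refine functor_ext (fun A => ?_) fun φ => ?_
  · exact ((h.inclusion U' U).comp_obj_ofPlace _ A).trans ((U.realize_obj_ofPlace _).trans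
      (congrArg L.obj (U'.realize_obj_ofPlace A)).symm)
  · exact ((h.inclusion U' U).comp_arr_gen _ φ).trans ((U.realize_arr_gen _).trans
      (congrArg L.arr (U'.realize_arr_gen φ)).symm)

end IsRestriction

/-- All three categories are free by unique lifting. Whether a lifted place or transition belongs to
one of the subnets is decided by the generator below it, so covering and disjointness are inherited
from `a` and `b`. -/
theorem isErasingOfFree_of_isRestriction {E Ew EK : Type u} [Category.{u} E] [StrictSymmMon E]
    [Category.{u} Ew] [StrictSymmMon Ew] [Category.{u} EK] [StrictSymmMon EK]
    {N Nw K : PetriNet.{u}} {a : Inclusion Nw N} {b : Inclusion K N}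
    {P : StrictFunctor E N.Free} {Pw : StrictFunctor Ew Nw.Free} {PK : StrictFunctor EK K.Free}
    {Lw : StrictFunctor Ew E} {LK : StrictFunctor EK E} (U : UniqueLifting P)
    (Uw : UniqueLifting Pw) (UK : UniqueLifting PK) (hw : IsRestriction Lw Pw P a.functor)
    (hK : IsRestriction LK PK P b.functor) (h : Complementary a b) :
    IsErasingOfFree Lw.toHom LK.toHom := by
  refine ⟨U.net, Uw.net, UK.net, U.freeIso, Uw.freeIso, UK.freeIso, (hw.inclusion Uw U).trivial,
    (hK.inclusion UK U).trivial, hw.inclusion_comp_realize Uw U, hK.inclusion_comp_realize UK U,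
    Complementary.isErasing ⟨fun A => ?_, fun φ => ?_, fun ψ χ e => ?_⟩⟩
  · obtain ⟨p, hp⟩ := A.2
    obtain ⟨q, rfl⟩ := h.place p
    exact hK.exists_place UK U A q hp
  · obtain ⟨t, ht⟩ := φ.2
    rcases h.cover t with ⟨s, rfl⟩ | ⟨s, rfl⟩
    · exact Or.inl (hw.exists_trans Uw U φ s ht)
    · exact Or.inr (hK.exists_trans UK U φ s ht)
  · obtain ⟨s, hs⟩ := hw.arr_trans Uw U ψ
    obtain ⟨r, hr⟩ := hK.arr_trans UK U χ
    rw [e] at hs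
    exact h.disjoint s r (gen_injective (hs.symm.trans hr))

/-! ### Internalizations -/

section

variable {C : Type u₁} [Category.{v₁} C] [StrictSymmMon C] {E : Elements.{w} C}

/-! ### Unique lifting and pullback squares for the Grothendieck construction. -/

namespace Total

variable {W : Witnesses.{v} E}

theorem elt_heq_of_eq {A B : Total W} (h : A = B) : HEq A.elt B.elt := by subst h; rfl

/-- Elements and witnesses of products are pairs, and witnesses of composites are pairs of
composable witnesses. -/
theorem uniqueLifting (unit : ∀ x : E.El 1, x = E.unit)
    (pair_surj : ∀ (X Y : C) (x : E.El (X * Y)), ∃ y z, x = E.pair y z)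
    (pair_inj : ∀ (X Y : C) (x x' : E.El X) (y y' : E.El Y), E.pair x y = E.pair x' y' →
      x = x' ∧ y = y')
    (comp_bij : ∀ {X Y Z : C} (f : X ⟶ Y) (g : Y ⟶ Z) (x : E.El X) (z : E.El Z),
      Function.Bijective
        (fun p : (Σ y : E.El Y, W.Wit f x y × W.Wit g y z) => W.comp p.2.1 p.2.2))
    (tensor_bij : ∀ {X Y X' Y' : C} (f : X ⟶ Y) (g : X' ⟶ Y') (x : E.El X) (y : E.El Y)
      (x' : E.El X') (y' : E.El Y'),
      Function.Bijective (fun p : W.Wit f x y × W.Wit g x' y' => W.tensor p.1 p.2)) :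
    UniqueLifting (proj W) := by
  -- A witness of an identity from `x` to `y` can be composed with an identity witness on either
  -- side. The results are equal but pass through the middle elements `x` and `y`, so uniqueness of
  -- factorizations gives `x = y`.
  have id_eq : ∀ {X : C} {f : X ⟶ X} {x y : E.El X} (s : W.Wit f x y), f = 𝟙 X → x = y := by
    rintro X _ x y s rfl
    have e : W.comp (W.id x) s = W.comp s (W.id y) :=
      eq_of_heq ((W.id_comp s).trans (W.comp_id s).symm)
    exact congrArg Sigma.fst ((comp_bij (𝟙 X) (𝟙 X) x y).1
      (a₁ := ⟨x, W.id x, s⟩) (a₂ := ⟨y, s, W.id y⟩) e)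
  have obj_inj : ∀ A B A' B' : Total W, A * B = A' * B' → A.base = A'.base → B.base = B'.base →
      A = A' ∧ B = B' := by
    rintro ⟨a, x⟩ ⟨b, y⟩ ⟨a', x'⟩ ⟨b', y'⟩ h ha hb
    cases ha
    cases hb
    obtain ⟨rfl, rfl⟩ := pair_inj _ _ _ _ _ _ (eq_of_heq (elt_heq_of_eq h))
    exact ⟨rfl, rfl⟩
  refine ⟨?_, ?_, obj_inj, ?_, ?_, ?_, ?_, ?_, ?_⟩
  · rintro ⟨_, x⟩ rfl
    cases unit x
    rfl
  · rintro ⟨_, x⟩ b c rfl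
    obtain ⟨y, z, rfl⟩ := pair_surj _ _ x
    exact ⟨⟨b, y⟩, ⟨c, z⟩, rfl, rfl, rfl⟩
  · rintro ⟨⟨a, x⟩, ⟨b, y⟩, f, s⟩ c h
    change Arr.mk a b f = Arr.mk c c (𝟙 c) at h
    cases h
    obtain rfl := id_eq s rfl
    obtain rfl : s = W.id x := (W.id_subsingleton x x).elim _ _
    exact ⟨⟨_, x⟩, rfl, rfl⟩
  · rintro ⟨⟨a, x⟩, ⟨c, z⟩, q, s⟩ a' b' c' f g h
    change Arr.mk a c q = Arr.mk a' c' (f ≫ g) at h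
    cases h
    obtain ⟨⟨y, s, t⟩, rfl⟩ := (comp_bij f g x z).2 s
    exact ⟨⟨_, x⟩, ⟨_, y⟩, ⟨_, z⟩, ⟨f, s⟩, ⟨g, t⟩, rfl, rfl, rfl⟩
  · rintro ⟨a, x⟩ ⟨b, y⟩ ⟨c, z⟩ ⟨a', x'⟩ ⟨b', y'⟩ ⟨c', z'⟩ ⟨f, s⟩ ⟨g, t⟩ ⟨f', s'⟩ ⟨g', t'⟩ h hf hg
    cases hf
    cases hg
    obtain rfl : x = x' := eq_of_heq (elt_heq_of_eq (congrArg Arr.src h :))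
    obtain rfl : z = z' := eq_of_heq (elt_heq_of_eq (congrArg Arr.tgt h :))
    have h := eq_of_heq (Sigma.mk.inj (Arr.eq_of_of_eq h)).2
    cases (comp_bij f g x z).1 (a₁ := ⟨y, s, t⟩) (a₂ := ⟨y', s', t'⟩) h
    exact ⟨rfl, rfl⟩
  · rintro ⟨⟨_, x⟩, ⟨_, y⟩, _, s⟩ ⟨a, b, f⟩ ⟨a', b', g⟩ h
    cases h
    obtain ⟨x, x', rfl⟩ := pair_surj _ _ x
    obtain ⟨y, y', rfl⟩ := pair_surj _ _ y
    obtain ⟨⟨s, t⟩, rfl⟩ := (tensor_bij f g x y x' y').2 s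
    exact ⟨⟨⟨a, x⟩, ⟨b, y⟩, f, s⟩, ⟨⟨a', x'⟩, ⟨b', y'⟩, g, t⟩, rfl, rfl, rfl⟩
  · rintro ⟨⟨a, x⟩, ⟨b, y⟩, f, s⟩ ⟨⟨c, z⟩, ⟨d, r⟩, g, t⟩ ⟨⟨a', x'⟩, ⟨b', y'⟩, f', s'⟩
      ⟨⟨c', z'⟩, ⟨d', r'⟩, g', t'⟩ h hf hg
    cases hf
    cases hg
    obtain ⟨rfl, rfl⟩ := pair_inj _ _ _ _ _ _ (eq_of_heq (elt_heq_of_eq (congrArg Arr.src h)))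
    obtain ⟨rfl, rfl⟩ := pair_inj _ _ _ _ _ _ (eq_of_heq (elt_heq_of_eq (congrArg Arr.tgt h)))
    have h := eq_of_heq (Sigma.mk.inj (Arr.eq_of_of_eq h)).2
    cases (tensor_bij f g x y z r).1 (a₁ := ⟨s, t⟩) (a₂ := ⟨s', t'⟩) h
    exact ⟨rfl, rfl⟩
  · rintro ⟨⟨_, x⟩, ⟨_, y⟩, _, s⟩ a b h
    cases h
    obtain ⟨x, x', rfl⟩ := pair_surj _ _ x
    obtain ⟨y', y, rfl⟩ := pair_surj _ _ y
    -- Followed by the reverse braiding, `s` becomes a witness of an identity. So its source and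
    -- target coincide, which says that the target of `s` is the swapped pair.
    obtain ⟨rfl, rfl⟩ := pair_inj _ _ _ _ _ _
      (id_eq (W.comp s (W.braid y' y)) (StrictSymmMon.braid_braid a b))
    obtain rfl : s = W.braid x x' := (W.braid_subsingleton _ _).elim _ _
    exact ⟨⟨a, x⟩, ⟨b, x'⟩, rfl, rfl, rfl⟩

/-- A morphism of a Grothendieck construction consists of a base morphism, two elements and a
witness. If elements and witnesses correspond bijectively, the morphisms over `g` and those over its
image under `G` are the same data. -/
theorem isRestriction_lift {C' : Type u₁} [Category.{v₁} C'] [StrictSymmMon C']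
    {E' : Elements.{w} C'} (W' : Witnesses.{v} E') (W : Witnesses.{v} E) (G : StrictFunctor C' C)
    (onEl : ∀ {X : C'}, E'.El X → E.El (G.obj X))
    (onWit : ∀ {X Y : C'} {f : X ⟶ Y} {x : E'.El X} {y : E'.El Y},
      W'.Wit f x y → W.Wit (G.map f) (onEl x) (onEl y)) (h_unit) (h_pair) (h_comp) (h_tensor)
    (hEl : ∀ X, Function.Bijective (onEl (X := X)))
    (hWit : ∀ {X Y : C'} (f : X ⟶ Y) (x : E'.El X) (y : E'.El Y),
      Function.Bijective (onWit (f := f) (x := x) (y := y))) :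
    IsRestriction (lift W' W G onEl onWit h_unit h_pair h_comp h_tensor) (proj W') (proj W) G := by
  refine ⟨fun _ => rfl, ?_, ?_⟩
  · rintro ⟨⟨_, x⟩, ⟨_, y⟩, _, s⟩ ⟨a, b, f⟩ h
    cases h
    obtain ⟨x, rfl⟩ := (hEl _).2 x
    obtain ⟨y, rfl⟩ := (hEl _).2 y
    obtain ⟨s, rfl⟩ := (hWit f x y).2 s
    exact ⟨⟨⟨a, x⟩, ⟨b, y⟩, f, s⟩, rfl, rfl⟩
  · rintro ⟨⟨a, x⟩, ⟨b, y⟩, f, s⟩ ⟨⟨a', x'⟩, ⟨b', y'⟩, f', s'⟩ hP hL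
    cases hP
    cases (hEl _).1 (eq_of_heq (elt_heq_of_eq (congrArg Arr.src hL)))
    cases (hEl _).1 (eq_of_heq (elt_heq_of_eq (congrArg Arr.tgt hL)))
    cases (hWit f x y).1 (eq_of_heq (Sigma.mk.inj (Arr.eq_of_of_eq hL)).2)
    rfl

end Total

end

/-! ### Partial functions. -/

namespace SetStar

variable {C : Type u₁} [Category.{v₁} C] [StrictSymmMon C]

theorem exists_elements_pair (F : StrictFunctor C SetStar.{u}) (X Y : C)
    (x : (elements F).El (X * Y)) : ∃ y z, x = (elements F).pair (X := X) (Y := Y) y z := by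
  obtain ⟨y, z, h⟩ := exists_pair (cast (congrArg El (F.obj_mul X Y)) x)
  exact ⟨y, z, eq_of_heq ((cast_heq _ _).symm.trans
    ((heq_of_eq h).trans (elements_pair_heq F y z).symm))⟩

theorem elements_pair_inj (F : StrictFunctor C SetStar.{u}) (X Y : C)
    (x x' : (elements F).El X) (y y' : (elements F).El Y)
    (h : (elements F).pair x y = (elements F).pair x' y') : x = x' ∧ y = y' :=
  pair_inj ((cast_inj _).1 h)

theorem elements_unit_unique (F : StrictFunctor C SetStar.{u}) (x : (elements F).El 1) :
    x = (elements F).unit :=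
  (cast_inj (congrArg El F.obj_one)).1 rfl

/-- Witnesses are proofs, so in a factorization only the middle element could vary, and a partial
function has at most one value. -/
theorem uniqueLifting (F : StrictFunctor C SetStar.{u}) :
    UniqueLifting (Total.proj (witnesses F)) := by
  refine Total.uniqueLifting (elements_unit_unique F) (exists_elements_pair F)
    (elements_pair_inj F) ?_ ?_
  · intro X Y Z f g x z
    constructor
    · rintro ⟨y, ⟨s⟩, ⟨t⟩⟩ ⟨y', ⟨s'⟩, ⟨t'⟩⟩ -
      cases Part.mem_unique s s'
      rfl
    · rintro ⟨s⟩
      obtain ⟨y, h, h'⟩ := (maps_map_comp F f g x z).1 s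
      exact ⟨⟨y, ⟨h⟩, ⟨h'⟩⟩, rfl⟩
  · intro X Y X' Y' f g x y x' y'
    constructor
    · rintro ⟨⟨s⟩, ⟨t⟩⟩ ⟨⟨s'⟩, ⟨t'⟩⟩ -
      rfl
    · rintro ⟨s⟩
      obtain ⟨h, h'⟩ := (maps_map_tensor F f g x y x' y').1 s
      exact ⟨⟨⟨h⟩, ⟨h'⟩⟩, rfl⟩

theorem isRestriction {C' : Type u₁} [Category.{v₁} C'] [StrictSymmMon C']
    (G : StrictFunctor C' C) {F : StrictFunctor C SetStar.{u}} {F' : StrictFunctor C' SetStar.{u}}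
    (h : F' = G.comp F) :
    IsRestriction (lift G h) (Total.proj (witnesses F')) (Total.proj (witnesses F)) G := by
  -- After the substitution, elements and witnesses on the two sides agree by definition up to
  -- rewrapping of proofs.
  subst h
  change IsRestriction (liftComp G F) _ _ G
  unfold liftComp
  apply Total.isRestriction_lift _ _ _ _ _ _ _ _ _ (fun _ => Function.bijective_id)
  refine fun f x y => ⟨?_, ?_⟩
  · rintro ⟨s⟩ ⟨s'⟩ -
    rfl
  · rintro ⟨s⟩
    exact ⟨⟨s⟩, rfl⟩

end SetStar

/-! ### Spans. -/

namespace SpanCat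

variable {C : Type u₁} [Category.{v₁} C] [StrictSymmMon C]

theorem exists_elements_pair (F : StrictFunctor C SpanCat.{u}) (X Y : C)
    (x : (elements F).El (X * Y)) : ∃ y z, x = (elements F).pair (X := X) (Y := Y) y z := by
  obtain ⟨y, z, h⟩ := exists_pair (cast (congrArg El (F.obj_mul X Y)) x)
  exact ⟨y, z, eq_of_heq ((cast_heq _ _).symm.trans
    ((heq_of_eq h).trans (elements_pair_heq F y z).symm))⟩

theorem elements_pair_inj (F : StrictFunctor C SpanCat.{u}) (X Y : C)
    (x x' : (elements F).El X) (y y' : (elements F).El Y)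
    (h : (elements F).pair x y = (elements F).pair x' y') : x = x' ∧ y = y' :=
  pair_inj ((cast_inj _).1 h)

theorem elements_unit_unique (F : StrictFunctor C SpanCat.{u}) (x : (elements F).El 1) :
    x = (elements F).unit :=
  (cast_inj (congrArg El F.obj_one)).1 rfl

/-- The conditions on witnesses are part of a realization: the apex of a composite is the pullback,
and that of a tensor product is the product. -/
theorem uniqueLifting {F : StrictFunctor C SpanCat.{u}} (R : Realization F) :
    UniqueLifting (Total.proj R.toWitnesses) :=
  Total.uniqueLifting (elements_unit_unique F) (exists_elements_pair F) (elements_pair_inj F)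
    R.comp_bijective R.tensor_bijective

theorem isRestriction {C' : Type u₁} [Category.{v₁} C'] [StrictSymmMon C']
    (G : StrictFunctor C' C) {F : StrictFunctor C SpanCat.{u}} {F' : StrictFunctor C' SpanCat.{u}}
    (h : F' = G.comp F) (R : Realization F) :
    IsRestriction (lift G h R) (Total.proj (R.restrict G h).toWitnesses)
      (Total.proj R.toWitnesses) G := by
  subst h
  change IsRestriction (liftComp G R) _ (Total.proj R.toWitnesses) G
  unfold liftComp
  apply Total.isRestriction_lift _ _ _ _ _ _ _ _ _ (fun _ => Function.bijective_id)
  exact fun _ _ _ => Function.bijective_id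

end SpanCat

end GuardedNets

theorem mainTheorem10 :
    (∀ (N Nw K : NetSem.{u} SetStar.{u}) (subw : Subnet Nw N) (subK : Subnet K N),
      IsErasing subw subK →
        IsErasingOfFree
          (SetStar.lift subw.toInclusion.functor subw.sem_eq).toHom
          (SetStar.lift subK.toInclusion.functor subK.sem_eq).toHom) ∧
    (∀ (N Nw K : NetSem.{u} SpanCat.{u}) (subw : Subnet Nw N) (subK : Subnet K N)
      (R : SpanCat.Realization N.sem),
      IsErasing subw subK →
        IsErasingOfFree
          (SpanCat.lift subw.toInclusion.functor subw.sem_eq R).toHom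
          (SpanCat.lift subK.toInclusion.functor subK.sem_eq R).toHom) :=
  ⟨fun N Nw K subw subK h => isErasingOfFree_of_isRestriction (SetStar.uniqueLifting N.sem)
      (SetStar.uniqueLifting Nw.sem) (SetStar.uniqueLifting K.sem)
      (SetStar.isRestriction _ subw.sem_eq) (SetStar.isRestriction _ subK.sem_eq)
      (Complementary.of_isErasing h),
    fun N Nw K subw subK R h => isErasingOfFree_of_isRestriction (SpanCat.uniqueLifting R)
      -- The restricted realizations are again realizations, so the internalizations of the two
      -- subnets have unique lifting over their own free categories.
      (SpanCat.uniqueLifting (R.restrict _ subw.sem_eq))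
      (SpanCat.uniqueLifting (R.restrict _ subK.sem_eq))
      (SpanCat.isRestriction _ subw.sem_eq R) (SpanCat.isRestriction _ subK.sem_eq R)
      (Complementary.of_isErasing h)⟩
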